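/- Let $\alpha\ge 1$ and let $\beta\ge 1$ be odd. For $\mathbf u=(u\mid u'),\mathbf v=(v\mid v')\in\mathbb Z_2^\alpha\times\mathbb Z_4^\beta$ put $\mathbf u\cdot\mathbf v=2\sum_i u_iv_i+\sum_j u'_jv'_j\in\mathbb Z_4$ (binary digits $0,1$ being read in $\mathbb Z_4$), and for a subgroup $\mathcal C$ let $\mathcal C^\perp=\{\mathbf v : \mathbf u\cdot\mathbf v=0 \text{ for all } \mathbf u\in\mathcal C\}$. Identify $\mathbb Z_2^\alpha\times\mathbb Z_4^\beta$ with $R_{\alpha,\beta}=\mathbb Z_2[x]/(x^\alpha-1)\times\mathbb Z_4[x]/(x^\beta-1)$ via $(u\mid u')\mapsto(\sum_i u_ix^i\mid\sum_j u'_jx^j)$; $R_{\alpha,\beta}$ is a $\mathbb Z_4[x]$-module under $\lambda\star(p\mid q)=(\lambda p \bmod 2\mid\lambda q)$, and $\mathbb Z_2\mathbb Z_4$-additive cyclic codes are its submodules. We say that a code $\mathcal C=\langle(b\mid 0),(\ell\mid fh+2f)\rangle$ (generated as a $\mathbb Z_4[x]$-module) is in standard form, with data $b,\ell\in\mathbb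 Z_2[x]$ and $f,g,h\in\mathbb Z_4[x]$, if $f,g,h$ are monic, $fgh=x^\beta-1$, $b\mid x^\alpha-1$, $\deg\ell<\deg b$, and $b$ divides $\frac{x^\beta-1}{f}\,\ell$ modulo $2$ (here $\deg 0=-\infty$). For a polynomial $p\neq0$ let $p^*(x)=x^{\deg p}p(x^{-1})$, and $0^*=0$. A polynomial in $\mathbb Z_4[x]$ is the Hensel lift of $q\in\mathbb Z_2[x]$ if it is the monic divisor of $x^\beta-1$ in $\mathbb Z_4[x]$ that reduces to $q$ modulo $2$. Let $\mathfrak m=\mathrm{lcm}(\alpha,\beta)$. In formulas over $\mathbb Z_2$, the letters $f,g,h$ stand for their reductions modulo $2$. **Theorem.** Let $\mathcal C=\langle(b\mid 0),(\ell\mid fh+2f)\rangle$ be a $\mathbb Z_2\mathbb Z_4$-additive cyclic code in standard form. Then $\mathcal C^\perp$ also has generators $\langle(\bar b\mid 0),(\bar\ell\mid\bar f\bar h+2\bar f)\rangle$ in standard form, with $\bar f\bar g\bar h=x^\beta-1$, and any such generators satisfy the following, where $\rho=\ell/\gcd(b,\ell)$ and all quotients of polynomials are exact in $\mathbb Z_2[x]$: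 1. $\displaystyle\bar b=\frac{x^\alpha-1}{\gcd(b,\ell)^*}$; 2. $\bar f\bar h$ is the Hensel lift of $\displaystyle\frac{(x^\beta-1)\gcd(b,\ell g)^*}{f^*b^*}$; 3. $\bar f$ is the Hensel lift of $\displaystyle\frac{(x^\beta-1)\gcd(b,\ell)^*}{f^*h^*\gcd(b,\ell g)^*}$; 4. $\rho^*$ is invertible modulo $\frac{b^*}{\gcd(b,\ell g)^*}$ and modulo $\frac{b^*}{\gcd(b,\ell)^*}$, and $\bar\ell$ is the remainder modulo $\bar b$ of $$\frac{x^\alpha-1}{b^*}\left(\frac{\gcd(b,\ell g)^*}{\gcd(b,\ell)^*}\,x^{\mathfrak m-\deg f}\mu_1+\frac{b^*}{\gcd(b,\ell g)^*}\,x^{\mathfrak m-\deg(fh)}\mu_2\right)\in\mathbb Z_2[x],$$ where $\mu_1,\mu_2\in\mathbb Z_2[x]$ are any polynomials with $$\mu_1\equiv x^{\deg\ell}(\rho^*)^{-1}\ \left(\mathrm{mod}\ \tfrac{b^*}{\gcd(b,\ell g)^*}\right),\qquad \mu_2\equiv x^{\deg\ell}(\rho^*)^{-1}\ \left(\mathrm{mod}\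 \tfrac{b^*}{\gcd(b,\ell)^*}\right).$$ (When $\ell=0$ both moduli are $1$ and $x^{\deg\ell}$ is read as $1$; then $\bar\ell=0$.) -/

import Mathlib

open Polynomial

namespace Z2Z4

/-- The ambient group `ℤ₂^α × ℤ₄^β`; its elements are the vectors `(u ∣ u')`. -/
abbrev Ambient (α β : ℕ) : Type := (Fin α → ZMod 2) × (Fin β → ZMod 4)

/-- A `ℤ₂ℤ₄`-additive code: a subgroup of `ℤ₂^α × ℤ₄^β`. -/
abbrev Code (α β : ℕ) : Type := AddSubgroup (Ambient α β)

/-- The inner product `2 (∑ uᵢ vᵢ) + ∑ u'ⱼ v'ⱼ ∈ ℤ₄`, where binary zeros and ones are read as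
zeros and ones in `ℤ₄`. -/
def innerProd {α β : ℕ} (u v : Ambient α β) : ZMod 4 :=
  2 * (∑ i, ((u.1 i).val : ZMod 4) * ((v.1 i).val : ZMod 4)) + ∑ j, u.2 j * v.2 j

theorem innerProd_zero {α β : ℕ} (u : Ambient α β) : innerProd u 0 = 0 := by
  simp [innerProd]

theorem innerProd_add {α β : ℕ} (u v w : Ambient α β) :
    innerProd u (v + w) = innerProd u v + innerProd u w := by
  have key : ∀ a b c : ZMod 2, (2 : ZMod 4) * ((a.val : ZMod 4) * ((b + c).val : ZMod 4)) =
      2 * ((a.val : ZMod 4) * (b.val : ZMod 4)) + 2 * ((a.val : ZMod 4) * (c.val : ZMod 4)) := by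
    decide
  simp only [innerProd, Prod.fst_add, Prod.snd_add, Pi.add_apply, Finset.mul_sum, key, mul_add,
    Finset.sum_add_distrib]
  ring

theorem innerProd_neg {α β : ℕ} (u v : Ambient α β) : innerProd u (-v) = -innerProd u v := by
  have h := innerProd_add u v (-v)
  rw [add_neg_cancel, innerProd_zero] at h
  exact (neg_eq_of_add_eq_zero_right h.symm).symm

/-- The dual code `𝒞^⊥ = {v ∣ u · v = 0 for all u ∈ 𝒞}`. -/
def dual {α β : ℕ} (C : Code α β) : Code α β where
  carrier := {v | ∀ u ∈ C, innerProd u v = 0}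
  zero_mem' := fun u _ => innerProd_zero u
  add_mem' := fun hv hw u hu => by rw [innerProd_add, hv u hu, hw u hu, add_zero]
  neg_mem' := fun hv u hu => by rw [innerProd_neg, hv u hu, neg_zero]

/-- Reduction modulo 2, `ℤ₄[x] → ℤ₂[x]`. -/
noncomputable def red : (ZMod 4)[X] →+* (ZMod 2)[X] :=
  Polynomial.mapRingHom (ZMod.castHom (by norm_num : 2 ∣ 4) (ZMod 2))

/-- The ring `ℤ₂[x]/(x^α - 1)`. -/
def BinPart (α : ℕ) : Type := (ZMod 2)[X] ⧸ Ideal.span {(X ^ α - 1 : (ZMod 2)[X])}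

/-- The ring `ℤ₄[x]/(x^β - 1)`. -/
abbrev QuatPart (β : ℕ) : Type := (ZMod 4)[X] ⧸ Ideal.span {(X ^ β - 1 : (ZMod 4)[X])}

noncomputable instance (α : ℕ) : CommRing (BinPart α) :=
  inferInstanceAs (CommRing ((ZMod 2)[X] ⧸ Ideal.span {(X ^ α - 1 : (ZMod 2)[X])}))

/-- The class of a binary polynomial in `ℤ₂[x]/(x^α - 1)`. -/
noncomputable def mkBin (α : ℕ) : (ZMod 2)[X] →+* BinPart α :=
  Ideal.Quotient.mk (Ideal.span {(X ^ α - 1 : (ZMod 2)[X])})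

/-- The class of a quaternary polynomial in `ℤ₄[x]/(x^β - 1)`. -/
noncomputable def mkQuat (β : ℕ) : (ZMod 4)[X] →+* QuatPart β :=
  Ideal.Quotient.mk (Ideal.span {(X ^ β - 1 : (ZMod 4)[X])})

/-- `ℤ₄[x]` acts on `ℤ₂[x]/(x^α - 1)` by multiplication with the reduction modulo 2. -/
noncomputable instance (α : ℕ) : Module (ZMod 4)[X] (BinPart α) :=
  Module.compHom (BinPart α) ((mkBin α).comp red)

/-- `R_{α,β} = ℤ₂[x]/(x^α - 1) × ℤ₄[x]/(x^β - 1)`, a `ℤ₄[x]`-module under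
`λ ⋆ (p ∣ q) = (λ p mod 2 ∣ λ q)`. -/
abbrev RModule (α β : ℕ) : Type := BinPart α × QuatPart β

theorem smul_mk {α β : ℕ} (c : (ZMod 4)[X]) (p : (ZMod 2)[X]) (q : (ZMod 4)[X]) :
    c • ((mkBin α p, mkQuat β q) : RModule α β) = (mkBin α (red c * p), mkQuat β (c * q)) := by
  refine Prod.ext ?_ ?_
  · exact (map_mul (mkBin α) (red c) p).symm
  · rfl

/-- The identification of a vector `(u ∣ u')` with `(∑ uᵢ xⁱ ∣ ∑ u'ⱼ xʲ)` in `R_{α,β}`. -/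
noncomputable def toR (α β : ℕ) : Ambient α β →+ RModule α β where
  toFun u := (mkBin α (∑ i : Fin α, C (u.1 i) * X ^ (i : ℕ)),
    mkQuat β (∑ j : Fin β, C (u.2 j) * X ^ (j : ℕ)))
  map_zero' := by simp
  map_add' u v := by
    simp only [Prod.fst_add, Prod.snd_add, Pi.add_apply, add_mul, Finset.sum_add_distrib,
      map_add, Prod.mk_add_mk]

/-- The code `⟨(b ∣ 0), (ℓ ∣ q)⟩`: the vectors whose polynomials lie in the `ℤ₄[x]`-submodule of
`R_{α,β}` generated by these two elements. -/
noncomputable def cyclicCode (α β : ℕ) (b l : (ZMod 2)[X]) (q : (ZMod 4)[X]) : Code α β :=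
  (Submodule.span (ZMod 4)[X]
    {((mkBin α b, 0) : RModule α β), (mkBin α l, mkQuat β q)}).toAddSubgroup.comap (toR α β)

/-- `𝒞 = ⟨(b ∣ 0), (ℓ ∣ f h + 2 f)⟩` in standard form: `f h g = x^β - 1` with monic factors,
`b ∣ x^α - 1`, `deg ℓ < deg b`, and `b` divides `((x^β - 1)/f) ℓ = h g ℓ` modulo 2.
Here `b` and `ℓ` are the polynomials representing their classes modulo `x^α - 1`. -/
structure HasGenerators {α β : ℕ} (𝒞 : Code α β) (b l : (ZMod 2)[X]) (f g h : (ZMod 4)[X]) :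
    Prop where
  monic_f : f.Monic
  monic_g : g.Monic
  monic_h : h.Monic
  factor : f * h * g = X ^ β - 1
  b_dvd : b ∣ X ^ α - 1
  deg_lt : l.degree < b.degree
  b_dvd_mul : b ∣ red (h * g) * l
  eq_code : 𝒞 = cyclicCode α β b l (f * h + 2 * f)

/-- `p` is the Hensel lift of the binary polynomial `q`, relative to (odd) length `β`: the monic
divisor of `x^β - 1` in `ℤ₄[x]` that reduces to `q` modulo 2. -/
def IsHenselLift (β : ℕ) (q : (ZMod 2)[X]) (p : (ZMod 4)[X]) : Prop :=
  p.Monic ∧ p ∣ X ^ β - 1 ∧ red p = q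

/-- The greatest common divisor in `ℤ₂[x]` (the only unit is 1, so it is unique). -/
noncomputable def pgcd (p q : (ZMod 2)[X]) : (ZMod 2)[X] :=
  EuclideanDomain.gcd p q

end Z2Z4

namespace Z2Z4

/-! The inner product is a trace form. Let `cyclicTrace` take the constant coefficient modulo `X ^ n
- 1`, and let `inversion` be `X ↦ X⁻¹`. The product of two vectors is then twice the binary trace of
`p(X⁻¹) p'` plus the quaternary trace of `q(X⁻¹) q'` (`innerProd_eq_cyclicTrace`). Since a cyclic
code is a module and the trace is nondegenerate, duality becomes a polynomial condition on the
reciprocals of the generators (`mem_dual_iff`), because `p(X⁻¹)` is `X ^ (m - deg p) p*` modulo `X ^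
m - 1`.

A vector of the dual has the form `(b' s ∣ g* t + 2 r)` with `b' = (X ^ α - 1) / b*`. For it the
pairing takes values in `2ℤ₄`, so only binary traces of lengths `α` and `β` remain. Comparing both
at length `lcm α β` turns orthogonality into a single divisibility in `ℤ₂[X]`
(`IsOrthogonal.iff_dvd`).

Write `gcd(b, ℓ)* = k`, `gcd(b, ℓ g)* = k u`, `b* = k u v`, `X ^ α - 1 = k u v w`. Standard form
forces `g* = u g₁` and `h* = v h₁` modulo 2, so `X ^ β - 1` regroups as `g₁ · (u h₁) · (f* v)`. The
lifts `F`, `H`, `G` of these factors generate the dual, with binary parts `u v w` and `w s`, where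
`s` solves `X ^ e ρ* s + X ^ i v + X ^ j u ≡ 0` modulo `u v` (`DualFactors.hasGenerators`,
`dvd_of_congruences`). Finally `b`, `ℓ`, `f` and `f h` are determined by the code
(`HasGenerators.unique`), so the formulas hold for every standard generating set of the dual. -/

/-! ### Reduction modulo 2 and Hensel lifting. -/

theorem red_surjective : Function.Surjective red :=
  Polynomial.map_surjective _ (ZMod.castHom_surjective (by norm_num : 2 ∣ 4))

theorem coeff_red (p : (ZMod 4)[X]) (i : ℕ) :
    (red p).coeff i = ZMod.castHom (by norm_num : 2 ∣ 4) (ZMod 2) (p.coeff i) :=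
  coeff_map _ _

theorem red_X : red X = X := map_X _

theorem red_two : red 2 = 0 := by
  rw [map_ofNat]
  exact CharTwo.two_eq_zero

theorem red_X_pow_sub_one (n : ℕ) : red (X ^ n - 1) = X ^ n - 1 := by
  rw [map_sub, map_pow, red_X, map_one]

theorem four_eq_zero : (4 : (ZMod 4)[X]) = 0 := by
  have h : (4 : ZMod 4) = 0 := by decide
  rw [← map_ofNat (C : ZMod 4 →+* (ZMod 4)[X]) 4]
  exact (congrArg C h).trans C_0

theorem two_mul_eq_zero_iff (p : (ZMod 4)[X]) : 2 * p = 0 ↔ red p = 0 := by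
  have key : ∀ a : ZMod 4, 2 * a = 0 ↔ ZMod.castHom (by norm_num : 2 ∣ 4) (ZMod 2) a = 0 := by
    decide
  have hc : ∀ i, (2 * p).coeff i = 2 * p.coeff i := fun i => by
    rw [← map_ofNat (C : ZMod 4 →+* (ZMod 4)[X]) 2, coeff_C_mul]
  rw [Polynomial.ext_iff, Polynomial.ext_iff]
  refine forall_congr' fun i => ?_
  rw [hc, coeff_red, coeff_zero, coeff_zero, key]

theorem red_eq_zero_iff (p : (ZMod 4)[X]) : red p = 0 ↔ ∃ q, p = 2 * q := by
  constructor
  · intro h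
    have key : ∀ a : ZMod 4, ZMod.castHom (by norm_num : 2 ∣ 4) (ZMod 2) a = 0 →
        ∃ c : ZMod 4, a = 2 * c := by decide
    have hk : ∀ i, ∃ c : ZMod 4, p.coeff i = 2 * c := fun i =>
      key _ (by rw [← coeff_red, h, coeff_zero])
    choose c hc using hk
    refine ⟨∑ i ∈ Finset.range (p.natDegree + 1), C (c i) * X ^ i, ?_⟩
    conv_lhs => rw [p.as_sum_range_C_mul_X_pow]
    rw [Finset.mul_sum]
    refine Finset.sum_congr rfl fun i _ => ?_
    rw [hc, C_mul, map_ofNat, mul_assoc]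
  · rintro ⟨q, rfl⟩
    rw [map_mul, red_two, zero_mul]

theorem red_eq_red_iff (p q : (ZMod 4)[X]) : red p = red q ↔ ∃ w, p = q + 2 * w := by
  rw [← sub_eq_zero, ← map_sub, red_eq_zero_iff]
  simp only [sub_eq_iff_eq_add']

theorem two_mul_congr {p q : (ZMod 4)[X]} (h : red p = red q) : 2 * p = 2 * q := by
  rw [← sub_eq_zero, ← mul_sub, two_mul_eq_zero_iff, map_sub, h, sub_self]

theorem monic_of_ne_zero {p : (ZMod 2)[X]} (hp : p ≠ 0) : p.Monic := by
  have key : ∀ a : ZMod 2, a ≠ 0 → a = 1 := by decide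
  exact key _ (leadingCoeff_ne_zero.mpr hp)

theorem eq_of_dvd_dvd {p q : (ZMod 2)[X]} (h : p ∣ q) (h' : q ∣ p) : p = q := by
  rcases eq_or_ne p 0 with rfl | hp
  · exact (zero_dvd_iff.mp h).symm
  · exact eq_of_monic_of_associated (monic_of_ne_zero hp)
      (monic_of_ne_zero (ne_zero_of_dvd_ne_zero hp h')) (associated_of_dvd_dvd h h')

theorem monic_X_pow_sub_one (R : Type*) [CommRing R] {n : ℕ} (hn : n ≠ 0) :
    (X ^ n - 1 : R[X]).Monic := by
  simpa using monic_X_pow_sub_C (1 : R) hn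

/-- The quotient vanishes modulo 2, hence is itself even, and the factor 2 cancels at the cost of
reducing modulo 2. -/
theorem red_dvd_of_dvd_two_mul {n : ℕ} (hn : n ≠ 0) {a : (ZMod 4)[X]}
    (h : X ^ n - 1 ∣ 2 * a) : (X ^ n - 1 : (ZMod 2)[X]) ∣ red a := by
  obtain ⟨d, hd⟩ := h
  have h1 : red d = 0 := by
    have := congrArg red hd
    rw [map_mul, map_mul, red_two, zero_mul, red_X_pow_sub_one] at this
    exact (mul_eq_zero.mp this.symm).resolve_left (monic_X_pow_sub_one _ hn).ne_zero
  obtain ⟨e, rfl⟩ := (red_eq_zero_iff d).mp h1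
  have h2 : 2 * (a - (X ^ n - 1) * e) = 0 := by
    rw [mul_sub, hd]; ring
  rw [two_mul_eq_zero_iff, map_sub, sub_eq_zero, map_mul, red_X_pow_sub_one] at h2
  exact ⟨_, h2⟩

/-- A lifted Bézout combination equals `1 + 2 w`, which is a unit with inverse `1 - 2 w` because `4
= 0`. -/
theorem isCoprime_of_red {p q : (ZMod 4)[X]} (h : IsCoprime (red p) (red q)) :
    IsCoprime p q := by
  obtain ⟨u, v, huv⟩ := h
  obtain ⟨u, rfl⟩ := red_surjective u
  obtain ⟨v, rfl⟩ := red_surjective v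
  have : red (u * p + v * q) = red 1 := by simpa using huv
  obtain ⟨w, hw⟩ := (red_eq_red_iff _ _).mp this
  refine ⟨u * (1 - 2 * w), v * (1 - 2 * w), ?_⟩
  linear_combination (1 - 2 * w) * hw - w ^ 2 * four_eq_zero

theorem separable_X_pow_sub_one {n : ℕ} (hn : Odd n) : (X ^ n - 1 : (ZMod 2)[X]).Separable := by
  rw [X_pow_sub_one_separable_iff]
  rw [Ne, ZMod.natCast_eq_zero_iff, ← even_iff_two_dvd]
  exact Nat.not_even_iff_odd.mpr hn

/-- Separability makes `q` coprime to its cofactor `r` modulo 2. Hence so is `p`, coprimality lifts,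
and `p ∣ q r` gives `p ∣ q`. -/
theorem dvd_of_red_dvd {n : ℕ} (hn : Odd n) {p q : (ZMod 4)[X]} (hp : p ∣ X ^ n - 1)
    (hq : q ∣ X ^ n - 1) (h : red p ∣ red q) : p ∣ q := by
  obtain ⟨r, hr⟩ := hq
  have hcop : IsCoprime (red q) (red r) := by
    apply Separable.isCoprime
    rw [← map_mul, ← hr, red_X_pow_sub_one]
    exact separable_X_pow_sub_one hn
  exact (isCoprime_of_red (hcop.of_isCoprime_of_dvd_left h)).dvd_of_dvd_mul_right (hr ▸ hp)

/-- Hensel's lemma: a coprime factorization modulo 2 lifts to `ℤ₄[x]`. -/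
theorem exists_lift_factorization {P : (ZMod 4)[X]} (hP : P.Monic) {a b : (ZMod 2)[X]}
    (hab : red P = a * b) (hcop : IsCoprime a b) :
    ∃ A B : (ZMod 4)[X], A.Monic ∧ B.Monic ∧ red A = a ∧ red B = b ∧ A * B = P := by
  have hab0 : a * b ≠ 0 := hab ▸ (hP.map _).ne_zero
  have ha0 : a ≠ 0 := left_ne_zero_of_mul hab0
  obtain ⟨A, hA, hAdeg, hAm⟩ := lifts_and_degree_eq_and_monic
    (f := ZMod.castHom (by norm_num : 2 ∣ 4) (ZMod 2)) (p := a)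
    ((mem_lifts _).mpr (red_surjective a)) (monic_of_ne_zero ha0)
  change red A = a at hA
  obtain ⟨B, rfl⟩ := red_surjective b
  obtain ⟨E, hE⟩ := (red_eq_red_iff P (A * B)).mp (by rw [map_mul, hA, hab])
  obtain ⟨u, v, huv⟩ := hcop
  -- With `P = A B + 2 E`, the corrections must satisfy `B S + A T ≡ E` modulo 2. Taking `S` to be a
  -- remainder modulo `a` keeps `A + 2 S` monic.
  obtain ⟨S, hS, hSdeg⟩ := exists_degree_eq_of_mem_lifts
    (f := ZMod.castHom (by norm_num : 2 ∣ 4) (ZMod 2)) (p := (v * red E) % a)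
    ((mem_lifts _).mpr (red_surjective _))
  change red S = _ at hS
  obtain ⟨T, hT⟩ : a ∣ red E - red B * red S := by
    have h1 : a ∣ v * red E - red S := by
      rw [hS]; exact (EuclideanDomain.mod_eq_sub_mul_div (v * red E) a) ▸ ⟨v * red E / a, by ring⟩
    obtain ⟨w, hw⟩ := h1
    exact ⟨u * red E + red B * w, by linear_combination red B * hw - red E * huv⟩
  obtain ⟨T, rfl⟩ := red_surjective T
  have hmonic : (A + 2 * S).Monic := by
    refine hAm.add_of_left ?_
    refine lt_of_le_of_lt ?_ (hAdeg ▸ hSdeg ▸ degree_mod_lt _ ha0)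
    rw [← map_ofNat (C : ZMod 4 →+* (ZMod 4)[X]) 2]
    exact (degree_mul_le _ _).trans ((add_le_add_left degree_C_le _).trans_eq (zero_add _))
  have hprod : (A + 2 * S) * (B + 2 * T) = P := by
    have h2 : 2 * (B * S + A * T) = 2 * E := two_mul_congr (by
      rw [map_add, map_mul, map_mul, hA]; linear_combination -hT)
    linear_combination h2 - hE + S * T * four_eq_zero
  refine ⟨A + 2 * S, B + 2 * T, hmonic, ?_, ?_, ?_, hprod⟩
  · exact hmonic.of_mul_monic_left (hprod ▸ hP)
  · rw [map_add, map_mul, red_two, zero_mul, add_zero, hA]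
  · rw [map_add, map_mul, red_two, zero_mul, add_zero]

/-! ### Reciprocal polynomials. -/

theorem red_reverse {p : (ZMod 4)[X]} (hp : p.Monic) : red p.reverse = (red p).reverse := by
  have : (red p).natDegree = p.natDegree := hp.natDegree_map _
  unfold reverse
  rw [this]
  exact (reflect_map _ _ _).symm

theorem reverse_mul_monic {R : Type*} [CommRing R] [Nontrivial R] {p q : R[X]} (hp : p.Monic)
    (hq : q.Monic) : (p * q).reverse = p.reverse * q.reverse :=
  reverse_mul (by rw [hp, hq, one_mul]; exact one_ne_zero)

theorem reverse_X_pow_sub_one {R : Type*} [CommRing R] [Nontrivial R] (n : ℕ) :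
    (X ^ n - 1 : R[X]).reverse = -(X ^ n - 1) := by
  have h : (X ^ n - 1 : R[X]).natDegree = n := by
    simpa using natDegree_X_pow_sub_C (R := R) (n := n) (r := 1)
  rw [reverse, h, reflect_sub, reflect_monomial, reflect_one, revAt_le le_rfl, Nat.sub_self]
  ring

theorem reverse_X_pow_sub_one_two (n : ℕ) :
    (X ^ n - 1 : (ZMod 2)[X]).reverse = X ^ n - 1 := by
  rw [reverse_X_pow_sub_one, CharTwo.neg_eq]

theorem reverse_dvd {p q : (ZMod 2)[X]} (h : p ∣ q) : p.reverse ∣ q.reverse := by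
  obtain ⟨r, rfl⟩ := h
  exact ⟨r.reverse, reverse_mul_of_domain p r⟩

theorem isCoprime_X_pow_of_coeff_zero {K : Type*} [Field K] {p : K[X]} (h : p.coeff 0 ≠ 0)
    (n : ℕ) : IsCoprime p (X ^ n) := by
  refine IsCoprime.pow_right ?_
  refine ⟨C (p.coeff 0)⁻¹, -(C (p.coeff 0)⁻¹ * p.divX), ?_⟩
  nth_rw 2 [← p.divX_mul_X_add]
  have : (C (p.coeff 0)⁻¹ * C (p.coeff 0) : K[X]) = 1 := by
    rw [← C_mul, inv_mul_cancel₀ h, C_1]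
  linear_combination this

/-- Reflecting a Bézout identity writes a power of `X` as a combination of the reciprocals, and
`p.reverse` is coprime to `X` since its constant term is the leading coefficient of `p`. -/
theorem isCoprime_reverse {K : Type*} [Field K] {p q : K[X]} (hp : p ≠ 0) (h : IsCoprime p q) :
    IsCoprime p.reverse q.reverse := by
  obtain ⟨u, v, huv⟩ := h
  set M := u.natDegree + v.natDegree
  have e1 : reflect ((M + q.natDegree) + p.natDegree) (u * p) =
      reflect (M + q.natDegree) u * p.reverse :=
    reflect_mul _ _ (by omega) le_rfl
  have e2 : reflect ((M + p.natDegree) + q.natDegree) (v * q) =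
      reflect (M + p.natDegree) v * q.reverse :=
    reflect_mul _ _ (by omega) le_rfl
  have hN : M + p.natDegree + q.natDegree = M + q.natDegree + p.natDegree := by ring
  have e3 := congrArg (reflect (M + q.natDegree + p.natDegree)) huv
  rw [reflect_add, e1, ← hN, e2, reflect_one] at e3
  have h0 : p.reverse.coeff 0 ≠ 0 := by
    rw [coeff_zero_reverse]; exact leadingCoeff_ne_zero.mpr hp
  obtain ⟨s, t, hst⟩ := isCoprime_X_pow_of_coeff_zero h0 (M + p.natDegree + q.natDegree)
  refine ⟨s + t * reflect (M + q.natDegree) u, t * reflect (M + p.natDegree) v, ?_⟩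
  linear_combination hst + t * e3

/-! ### The cyclic trace and its nondegeneracy. -/

/-- The constant coefficient of the remainder modulo `X ^ n - 1`: the sum of the coefficients
whose index is a multiple of `n`. -/
noncomputable def cyclicTrace (R : Type*) [CommRing R] (n : ℕ) : R[X] →ₗ[R] R :=
  lsum fun i => if n ∣ i then LinearMap.id else 0

section cyclicTrace

variable {R : Type*} [CommRing R]

theorem cyclicTrace_monomial (n i : ℕ) (a : R) :
    cyclicTrace R n (C a * X ^ i) = if n ∣ i then a else 0 := by
  rw [C_mul_X_pow_eq_monomial, cyclicTrace, lsum_apply, sum_monomial_index a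
    (fun j x => (if n ∣ j then LinearMap.id else 0 : R →ₗ[R] R) x) (map_zero _)]
  split_ifs <;> rfl

theorem cyclicTrace_X_pow (n i : ℕ) : cyclicTrace R n (X ^ i) = if n ∣ i then 1 else 0 := by
  simpa using cyclicTrace_monomial n i (1 : R)

theorem linearMap_ext_X_pow {M : Type*} [AddCommGroup M] [Module R M] {φ ψ : R[X] →ₗ[R] M}
    (h : ∀ i, φ (X ^ i) = ψ (X ^ i)) : φ = ψ := by
  refine lhom_ext' fun i => LinearMap.ext_ring ?_
  simpa [monomial_one_right_eq_X_pow] using h i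

theorem cyclicTrace_mul_eq_zero (n : ℕ) (p : R[X]) :
    cyclicTrace R n ((X ^ n - 1) * p) = 0 := by
  suffices h : (cyclicTrace R n).comp (LinearMap.mulLeft R (X ^ n - 1)) = 0 from
    LinearMap.congr_fun h p
  refine linearMap_ext_X_pow fun i => ?_
  simp only [LinearMap.comp_apply, LinearMap.mulLeft_apply, sub_mul, one_mul, ← pow_add, map_sub,
    cyclicTrace_X_pow, Nat.dvd_add_right (dvd_refl n), sub_self, LinearMap.zero_apply]

theorem cyclicTrace_congr {n : ℕ} {p q : R[X]} (h : X ^ n - 1 ∣ p - q) :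
    cyclicTrace R n p = cyclicTrace R n q := by
  obtain ⟨w, hw⟩ := h
  rw [← sub_eq_zero, ← map_sub, hw, cyclicTrace_mul_eq_zero]

/-- Multiplying by `X ^ (n - j)` brings the `j`-th coefficient of the remainder to the constant
position. -/
theorem cyclicTrace_nondegenerate {n : ℕ} (hn : n ≠ 0) {p : R[X]}
    (h : ∀ c, cyclicTrace R n (c * p) = 0) : X ^ n - 1 ∣ p := by
  cases subsingleton_or_nontrivial R
  · exact ⟨0, Subsingleton.elim _ _⟩
  have hm := monic_X_pow_sub_one R hn
  have hdeg : (X ^ n - 1 : R[X]).natDegree = n := by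
    simpa using natDegree_X_pow_sub_C (R := R) (n := n) (r := 1)
  rw [← modByMonic_eq_zero_iff_dvd hm]
  set r := p %ₘ (X ^ n - 1) with hr
  have hrdeg : r.natDegree < n := by
    have h1 : (X ^ n - 1 : R[X]) ≠ 1 := fun h1 => hn (by rw [← hdeg, h1, natDegree_one])
    exact (natDegree_modByMonic_lt p hm h1).trans_eq hdeg
  have hz : ∀ c, cyclicTrace R n (c * r) = 0 := fun c => by
    rw [← h c]
    refine cyclicTrace_congr ?_
    exact ⟨-(c * (p /ₘ (X ^ n - 1))), by linear_combination c * modByMonic_add_div p (X ^ n - 1)⟩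
  ext j
  rw [coeff_zero]
  rcases lt_or_ge j n with hj | hj
  · have h2 := hz (X ^ (n - j))
    rw [r.as_sum_range_C_mul_X_pow' hrdeg, Finset.mul_sum, map_sum,
      Finset.sum_eq_single j] at h2
    · rw [mul_left_comm, ← pow_add, cyclicTrace_monomial, if_pos] at h2
      · exact h2
      · rw [Nat.sub_add_cancel hj.le]
    · intro i hi hij
      rw [Finset.mem_range] at hi
      rw [mul_left_comm, ← pow_add, cyclicTrace_monomial, if_neg]
      rintro ⟨w, hw⟩
      have hw1 : w = 1 := by
        have a1 : 0 < w := Nat.pos_of_ne_zero (by rintro rfl; omega)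
        have a2 : w < 2 := by
          by_contra hw2
          have : n * 2 ≤ n * w := Nat.mul_le_mul_left _ (by omega)
          omega
        omega
      subst hw1
      omega
    · intro hj'
      exact absurd (Finset.mem_range.mpr hj) hj'
  · exact coeff_eq_zero_of_natDegree_lt (hrdeg.trans_le hj)

/-- Exactly one of `k` consecutive integers is a multiple of `k`. -/
theorem sum_dvd_add (k j : ℕ) (hk : k ≠ 0) :
    ∑ i ∈ Finset.range k, (if k ∣ j + i then (1 : R) else 0) = 1 := by
  induction j with
  | zero =>
    rw [Finset.sum_eq_single 0]
    · simp
    · intro i hi hi0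
      rw [zero_add, if_neg (Nat.not_dvd_of_pos_of_lt (Nat.pos_of_ne_zero hi0)
        (Finset.mem_range.mp hi))]
    · intro h; exact absurd (Finset.mem_range.mpr (Nat.pos_of_ne_zero hk)) h
  | succ j ih =>
    obtain ⟨k, rfl⟩ := Nat.exists_eq_succ_of_ne_zero hk
    rw [Finset.sum_range_succ'] at ih
    have e1 : ∀ i, j + 1 + i = j + (i + 1) := fun i => by ring
    simp only [e1]
    rw [Finset.sum_range_succ]
    simpa [Nat.dvd_add_left (dvd_refl (k + 1))] using ih

/-- The geometric sum is `(X ^ (n k) - 1) / (X ^ n - 1)`; it allows traces of different lengths to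
be compared at a common length. -/
theorem cyclicTrace_eq_mul (n : ℕ) {k : ℕ} (hn : n ≠ 0) (hk : k ≠ 0) (p : R[X]) :
    cyclicTrace R n p = cyclicTrace R (n * k) (p * ∑ i ∈ Finset.range k, (X ^ n) ^ i) := by
  suffices h : cyclicTrace R n = (cyclicTrace R (n * k)).comp
      (LinearMap.mulRight R (∑ i ∈ Finset.range k, (X ^ n) ^ i)) from LinearMap.congr_fun h p
  refine linearMap_ext_X_pow fun j => ?_
  rw [LinearMap.comp_apply, LinearMap.mulRight_apply, Finset.mul_sum, map_sum]
  simp only [← pow_mul, ← pow_add, cyclicTrace_X_pow]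
  split_ifs with hj
  · obtain ⟨j, rfl⟩ := hj
    simp only [← mul_add, Nat.mul_dvd_mul_iff_left (Nat.pos_of_ne_zero hn)]
    exact (sum_dvd_add k j hk).symm
  · symm
    refine Finset.sum_eq_zero fun i _ => if_neg fun h => hj ?_
    exact (Nat.dvd_add_left (dvd_mul_right n i)).mp ((dvd_mul_right n k).trans h)

end cyclicTrace

/-- At length `lcm a b` the two traces merge into one, and nondegeneracy applies. The resulting
divisibility says that `P / (X ^ a - 1) + Q / (X ^ b - 1)` is a polynomial. -/
theorem cyclicTrace_add_eq_zero_iff {a b : ℕ} (ha : a ≠ 0) (hb : b ≠ 0) (P Q : (ZMod 2)[X]) :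
    (∀ c, cyclicTrace (ZMod 2) a (c * P) + cyclicTrace (ZMod 2) b (c * Q) = 0) ↔
      (X ^ a - 1) * (X ^ b - 1) ∣ P * (X ^ b - 1) + Q * (X ^ a - 1) := by
  have hm : Nat.lcm a b ≠ 0 := Nat.lcm_ne_zero ha hb
  obtain ⟨i, hi⟩ := Nat.dvd_lcm_left a b
  obtain ⟨j, hj⟩ := Nat.dvd_lcm_right a b
  have hi0 : i ≠ 0 := by rintro rfl; exact hm (by simpa using hi)
  have hj0 : j ≠ 0 := by rintro rfl; exact hm (by simpa using hj)
  set m := Nat.lcm a b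
  set θ : (ZMod 2)[X] := ∑ t ∈ Finset.range i, (X ^ a) ^ t with hθ
  set η : (ZMod 2)[X] := ∑ t ∈ Finset.range j, (X ^ b) ^ t with hη
  have h1 : θ * (X ^ a - 1) = X ^ m - 1 := by rw [hθ, geom_sum_mul, ← pow_mul, ← hi]
  have h2 : η * (X ^ b - 1) = X ^ m - 1 := by rw [hη, geom_sum_mul, ← pow_mul, ← hj]
  have ea : ∀ c, cyclicTrace (ZMod 2) a c = cyclicTrace (ZMod 2) m (c * θ) := fun c => by
    rw [cyclicTrace_eq_mul a ha hi0, ← hi]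
  have eb : ∀ c, cyclicTrace (ZMod 2) b c = cyclicTrace (ZMod 2) m (c * η) := fun c => by
    rw [cyclicTrace_eq_mul b hb hj0, ← hj]
  have hA := (monic_X_pow_sub_one (ZMod 2) ha).ne_zero
  have hB := (monic_X_pow_sub_one (ZMod 2) hb).ne_zero
  have hM := (monic_X_pow_sub_one (ZMod 2) hm).ne_zero
  have h3 : (∀ c, cyclicTrace (ZMod 2) a (c * P) + cyclicTrace (ZMod 2) b (c * Q) = 0) ↔
      X ^ m - 1 ∣ P * θ + Q * η := by
    have e : ∀ c, cyclicTrace (ZMod 2) a (c * P) + cyclicTrace (ZMod 2) b (c * Q) =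
        cyclicTrace (ZMod 2) m (c * (P * θ + Q * η)) := fun c => by
      rw [ea, eb, ← map_add]; congr 1; ring
    simp only [e]
    refine ⟨cyclicTrace_nondegenerate hm, ?_⟩
    rintro ⟨w, hw⟩ c
    rw [hw, mul_left_comm, cyclicTrace_mul_eq_zero]
  rw [h3, ← mul_dvd_mul_iff_left (mul_ne_zero hA hB)]
  have e : (X ^ a - 1) * (X ^ b - 1) * (P * θ + Q * η) =
      (P * (X ^ b - 1) + Q * (X ^ a - 1)) * (X ^ m - 1) := by
    linear_combination P * (X ^ b - 1) * h1 + Q * (X ^ a - 1) * h2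
  rw [e, mul_dvd_mul_iff_right hM]

/-- The embedding `ℤ₂ → ℤ₄` with image `2ℤ₄`. -/
def twice : ZMod 2 →+ ZMod 4 where
  toFun a := 2 * (a.val : ZMod 4)
  map_zero' := by decide
  map_add' := by decide

theorem twice_eq_zero_iff : ∀ a, twice a = 0 ↔ a = 0 := by decide

theorem twice_mul : ∀ a b : ZMod 2, twice (a * b) = 2 * ((a.val : ZMod 4) * (b.val : ZMod 4)) := by
  decide

theorem cyclicTrace_two_mul (n : ℕ) (p : (ZMod 4)[X]) :
    cyclicTrace (ZMod 4) n (2 * p) = twice (cyclicTrace (ZMod 2) n (red p)) := by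
  have key : ∀ a : ZMod 4, 2 * a = twice (ZMod.castHom (by norm_num : 2 ∣ 4) (ZMod 2) a) := by
    decide
  induction p using Polynomial.induction_on' with
  | add p q hp hq => rw [mul_add, map_add, hp, hq, map_add, map_add, map_add]
  | monomial i a =>
    rw [← C_mul_X_pow_eq_monomial, map_mul red, map_pow, red_X,
      show red (C a) = C (ZMod.castHom (by norm_num : 2 ∣ 4) (ZMod 2) a) from map_C _,
      ← map_ofNat (C : ZMod 4 →+* (ZMod 4)[X]) 2, ← mul_assoc, ← C_mul, cyclicTrace_monomial,
      cyclicTrace_monomial]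
    split_ifs
    · exact key a
    · exact (map_zero _).symm

/-! ### Inversion of the variable. -/

/-- The substitution `X ↦ X ^ (m - 1)`, that is `X ↦ X⁻¹` modulo `X ^ m - 1`. -/
noncomputable def inversion (R : Type*) [CommRing R] (m : ℕ) : R[X] →ₐ[R] R[X] := expand R (m - 1)

theorem red_inversion (m : ℕ) (p : (ZMod 4)[X]) :
    red (inversion (ZMod 4) m p) = inversion (ZMod 2) m (red p) :=
  map_expand

section inversion

variable {R : Type*} [CommRing R]

theorem inversion_X_pow (m i : ℕ) : inversion R m (X ^ i) = X ^ ((m - 1) * i) := by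
  rw [inversion, map_pow, expand_X, pow_mul]

theorem X_pow_sub_one_dvd_of_dvd {n m : ℕ} (h : n ∣ m) : (X ^ n - 1 : R[X]) ∣ X ^ m - 1 := by
  obtain ⟨k, rfl⟩ := h
  rw [pow_mul]
  exact sub_one_dvd_pow_sub_one _ _

theorem dvd_inversion {n m : ℕ} {p : R[X]} (h : X ^ n - 1 ∣ p) :
    X ^ n - 1 ∣ inversion R m p := by
  obtain ⟨w, rfl⟩ := h
  rw [map_mul, map_sub, map_one, inversion_X_pow]
  exact (X_pow_sub_one_dvd_of_dvd (dvd_mul_left _ _)).mul_right _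

theorem dvd_inversion_inversion_sub {n m : ℕ} (hm : m ≠ 0) (h : n ∣ m) (p : R[X]) :
    X ^ n - 1 ∣ inversion R m (inversion R m p) - p := by
  rw [← Ideal.mem_span_singleton, ← Ideal.Quotient.eq]
  suffices h : (Ideal.Quotient.mkₐ R (Ideal.span {X ^ n - 1})).comp
      ((inversion R m).comp (inversion R m)) = Ideal.Quotient.mkₐ R (Ideal.span {X ^ n - 1}) from
    DFunLike.congr_fun h p
  refine algHom_ext ?_
  have hX : inversion R m X = X ^ ((m - 1) * 1) := by rw [← inversion_X_pow, pow_one]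
  change Ideal.Quotient.mk _ (inversion R m (inversion R m X)) = Ideal.Quotient.mk _ X
  rw [Ideal.Quotient.eq, Ideal.mem_span_singleton, hX, inversion_X_pow]
  obtain ⟨m, rfl⟩ := Nat.exists_eq_succ_of_ne_zero hm
  cases m with
  -- Here the length is 1 and the substitution is `X ↦ X ^ 0 = 1`, which agrees with `X` modulo `X -
  -- 1`.
  | zero =>
    obtain rfl : n = 1 := Nat.dvd_one.mp h
    exact ⟨-1, by simp⟩
  | succ m =>
    have e : (m + 1 + 1 - 1) * ((m + 1 + 1 - 1) * 1) = (m + 1 + 1) * m + 1 := by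
      simp only [Nat.add_sub_cancel]; ring
    rw [e]
    have : (X ^ n - 1 : R[X]) ∣ X ^ ((m + 1 + 1) * m) - 1 :=
      X_pow_sub_one_dvd_of_dvd (h.mul_right m)
    exact (this.mul_right X).trans (dvd_of_eq (by ring))

/-- The shifted reciprocal is `reflect m p`, whose exponents `m - i` are congruent to `(m - 1) i`
modulo `m`. -/
theorem dvd_inversion_sub_reverse {m : ℕ} (hm : m ≠ 0) {p : R[X]} (hp : p.natDegree ≤ m) :
    X ^ m - 1 ∣ inversion R m p - X ^ (m - p.natDegree) * p.reverse := by
  have h1 : X ^ (m - p.natDegree) * p.reverse = reflect m p := by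
    have := reflect_mul p 1 (F := p.natDegree) (G := m - p.natDegree) le_rfl (by simp)
    rw [mul_one, reflect_one, Nat.add_sub_cancel' hp] at this
    rw [this, mul_comm, reverse]
  rw [h1]
  have hsum := p.as_sum_range_C_mul_X_pow' (Nat.lt_succ_of_le hp)
  let φ : R[X] →+ R[X] :=
    { toFun := reflect m, map_zero' := reflect_zero, map_add' := fun a b => reflect_add a b m }
  have h2 : reflect m p = ∑ i ∈ Finset.range (m + 1), C (p.coeff i) * X ^ (m - i) := by
    conv_lhs => rw [hsum]
    rw [show reflect m _ = φ _ from rfl, map_sum]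
    refine Finset.sum_congr rfl fun i hi => ?_
    refine (reflect_C_mul_X_pow m i).trans ?_
    rw [revAt_le (Nat.lt_succ_iff.mp (Finset.mem_range.mp hi))]
  rw [h2]
  conv_rhs => enter [1]; rw [hsum]
  rw [map_sum, ← Finset.sum_sub_distrib]
  refine Finset.dvd_sum fun i hi => ?_
  have hi' := Nat.lt_succ_iff.mp (Finset.mem_range.mp hi)
  rw [map_mul, inversion_X_pow, ← algebraMap_eq, AlgHom.commutes, ← mul_sub]
  refine Dvd.dvd.mul_left ?_ _
  rcases Nat.eq_zero_or_pos i with rfl | hi0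
  · exact ⟨-1, by simp⟩
  · obtain ⟨i, rfl⟩ := Nat.exists_eq_succ_of_ne_zero hi0.ne'
    have e : (m - 1) * (i + 1) = m * i + (m - (i + 1)) := by
      obtain ⟨t, rfl⟩ := Nat.exists_eq_add_of_le hi'
      rw [Nat.succ_eq_add_one, Nat.add_sub_cancel_left]
      have : i + 1 + t - 1 = i + t := by omega
      rw [this]; ring
    rw [Nat.succ_eq_add_one, e]
    have : (X ^ m - 1 : R[X]) ∣ X ^ (m * i) - 1 := X_pow_sub_one_dvd_of_dvd (dvd_mul_right m i)
    exact (this.mul_right (X ^ (m - (i + 1)))).trans (dvd_of_eq (by ring))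

end inversion

/-! ### Vectors as polynomials, and the inner product as a trace. -/

/-- The polynomial with the entries of a vector as coefficients. -/
noncomputable def vecPoly {R : Type*} [CommRing R] {n : ℕ} (u : Fin n → R) : R[X] :=
  ∑ i : Fin n, C (u i) * X ^ (i : ℕ)

theorem toR_apply {α β : ℕ} (u : Ambient α β) :
    toR α β u = (mkBin α (vecPoly u.1), mkQuat β (vecPoly u.2)) := rfl

theorem exists_vecPoly {R : Type*} [CommRing R] {n : ℕ} (hn : n ≠ 0) (p : R[X]) :
    ∃ u : Fin n → R, X ^ n - 1 ∣ vecPoly u - p := by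
  cases subsingleton_or_nontrivial R
  · exact ⟨0, 0, Subsingleton.elim _ _⟩
  have hm := monic_X_pow_sub_one R hn
  have hdeg : (X ^ n - 1 : R[X]).natDegree = n := by
    simpa using natDegree_X_pow_sub_C (R := R) (n := n) (r := 1)
  have h1 : (X ^ n - 1 : R[X]) ≠ 1 := fun h1 => hn (by rw [← hdeg, h1, natDegree_one])
  have hr : (p %ₘ (X ^ n - 1)).natDegree < n := (natDegree_modByMonic_lt p hm h1).trans_eq hdeg
  refine ⟨fun i => (p %ₘ (X ^ n - 1)).coeff i, -(p /ₘ (X ^ n - 1)), ?_⟩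
  have e : vecPoly (fun i : Fin n => (p %ₘ (X ^ n - 1)).coeff i) = p %ₘ (X ^ n - 1) := by
    conv_rhs => rw [(p %ₘ (X ^ n - 1)).as_sum_range_C_mul_X_pow' hr]
    exact Fin.sum_univ_eq_sum_range (fun i => C ((p %ₘ (X ^ n - 1)).coeff i) * X ^ i) n
  rw [e]
  linear_combination modByMonic_add_div p (X ^ n - 1)

theorem mkBin_eq_iff {α : ℕ} (p q : (ZMod 2)[X]) :
    mkBin α p = mkBin α q ↔ X ^ α - 1 ∣ p - q := by
  rw [← Ideal.mem_span_singleton]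
  exact Ideal.Quotient.eq

theorem mkQuat_eq_iff {β : ℕ} (p q : (ZMod 4)[X]) :
    mkQuat β p = mkQuat β q ↔ X ^ β - 1 ∣ p - q := by
  rw [← Ideal.mem_span_singleton]
  exact Ideal.Quotient.eq

theorem exists_toR_eq {α β : ℕ} (hα : α ≠ 0) (hβ : β ≠ 0) (p : (ZMod 2)[X]) (q : (ZMod 4)[X]) :
    ∃ v : Ambient α β, toR α β v = (mkBin α p, mkQuat β q) := by
  obtain ⟨u, hu⟩ := exists_vecPoly hα p
  obtain ⟨w, hw⟩ := exists_vecPoly hβ q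
  exact ⟨(u, w), by rw [toR_apply, Prod.mk.injEq, mkBin_eq_iff, mkQuat_eq_iff]; exact ⟨hu, hw⟩⟩

theorem mem_cyclicCode_iff {α β : ℕ} {b l : (ZMod 2)[X]} {k : (ZMod 4)[X]} {v : Ambient α β}
    {p : (ZMod 2)[X]} {q : (ZMod 4)[X]} (hv : toR α β v = (mkBin α p, mkQuat β q)) :
    v ∈ cyclicCode α β b l k ↔ ∃ c d : (ZMod 4)[X],
      X ^ α - 1 ∣ p - (red c * b + red d * l) ∧ X ^ β - 1 ∣ q - d * k := by
  change toR α β v ∈ Submodule.span (ZMod 4)[X]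
    {((mkBin α b, 0) : RModule α β), (mkBin α l, mkQuat β k)} ↔ _
  rw [Submodule.mem_span_pair]
  refine exists_congr fun c => exists_congr fun d => ?_
  rw [hv, ← map_zero (mkQuat β), smul_mk, smul_mk, Prod.mk_add_mk, ← map_add, ← map_add, eq_comm,
    Prod.mk.injEq, mkBin_eq_iff, mkQuat_eq_iff, mul_zero, zero_add]

theorem dvd_add_iff_eq {n m i j : ℕ} (hm : m ≠ 0) (h : n ∣ m) (hi : i < n) (hj : j < n) :
    n ∣ (m - 1) * i + j ↔ i = j := by
  have e : (m - 1) * i + j + i = m * i + j := by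
    obtain ⟨m, rfl⟩ := Nat.exists_eq_succ_of_ne_zero hm
    rw [Nat.succ_eq_add_one, Nat.add_sub_cancel]; ring
  constructor
  · intro hd
    have h1 : i ≡ j [MOD n] := by
      have a1 : (m - 1) * i + j + i ≡ 0 + i [MOD n] :=
        Nat.ModEq.add_right _ ((Nat.modEq_zero_iff_dvd).mpr hd)
      have a2 : m * i + j ≡ 0 + j [MOD n] :=
        Nat.ModEq.add_right _ ((Nat.modEq_zero_iff_dvd).mpr (h.mul_right i))
      rw [zero_add] at a1 a2
      exact a1.symm.trans (e ▸ a2)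
    exact h1.eq_of_lt_of_lt hi hj
  · rintro rfl
    exact (Nat.add_right_cancel e) ▸ h.mul_right i

/-- The term in `u i * v j` has exponent congruent to `j - i` modulo `n`, so the trace keeps only
the diagonal. -/
theorem cyclicTrace_inversion_mul {R : Type*} [CommRing R] {n m : ℕ} (hm : m ≠ 0) (h : n ∣ m)
    (u v : Fin n → R) :
    cyclicTrace R n (inversion R m (vecPoly u) * vecPoly v) = ∑ i, u i * v i := by
  have e : inversion R m (vecPoly u) * vecPoly v =
      ∑ i : Fin n, ∑ j : Fin n, C (u i * v j) * X ^ ((m - 1) * i + j) := by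
    rw [vecPoly, vecPoly, map_sum, Finset.sum_mul_sum]
    refine Finset.sum_congr rfl fun i _ => Finset.sum_congr rfl fun j _ => ?_
    rw [map_mul, inversion_X_pow, ← algebraMap_eq, AlgHom.commutes, map_mul, pow_add]
    ring
  rw [e, map_sum]
  refine Finset.sum_congr rfl fun i _ => ?_
  rw [map_sum, Finset.sum_eq_single i]
  · rw [cyclicTrace_monomial, if_pos ((dvd_add_iff_eq hm h i.2 i.2).mpr rfl)]
  · intro j _ hij
    rw [cyclicTrace_monomial, if_neg]
    rw [dvd_add_iff_eq hm h i.2 j.2]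
    exact fun h => hij (Fin.ext h.symm)
  · intro hi; exact absurd (Finset.mem_univ i) hi

theorem cyclicTrace_inversion_congr {R : Type*} [CommRing R] {n m : ℕ} {p p' q q' : R[X]}
    (hp : X ^ n - 1 ∣ p - p') (hq : X ^ n - 1 ∣ q - q') :
    cyclicTrace R n (inversion R m p * q) = cyclicTrace R n (inversion R m p' * q') := by
  refine cyclicTrace_congr ?_
  have e : inversion R m p * q - inversion R m p' * q' =
      inversion R m (p - p') * q + inversion R m p' * (q - q') := by rw [map_sub]; ring
  rw [e]
  exact dvd_add ((dvd_inversion hp).mul_right _) (hq.mul_left _)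

theorem innerProd_eq_cyclicTrace {α β m : ℕ} (hm : m ≠ 0) (hα : α ∣ m) (hβ : β ∣ m)
    {u v : Ambient α β} {p p' : (ZMod 2)[X]} {q q' : (ZMod 4)[X]}
    (hu : toR α β u = (mkBin α p, mkQuat β q)) (hv : toR α β v = (mkBin α p', mkQuat β q')) :
    innerProd u v = twice (cyclicTrace (ZMod 2) α (inversion (ZMod 2) m p * p')) +
      cyclicTrace (ZMod 4) β (inversion (ZMod 4) m q * q') := by
  rw [toR_apply, Prod.mk.injEq, mkBin_eq_iff, mkQuat_eq_iff] at hu hv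
  rw [← cyclicTrace_inversion_congr hu.1 hv.1, ← cyclicTrace_inversion_congr hu.2 hv.2,
    cyclicTrace_inversion_mul hm hα, cyclicTrace_inversion_mul hm hβ, map_sum, innerProd,
    Finset.mul_sum]
  simp only [twice_mul]

/-! ### Uniqueness of standard generators. -/

theorem isCoprime_red_of_mul_dvd {n : ℕ} (hn : Odd n) {p q : (ZMod 4)[X]}
    (h : p * q ∣ X ^ n - 1) : IsCoprime (red p) (red q) := by
  have h1 := map_dvd red h
  rw [red_X_pow_sub_one, map_mul] at h1
  exact ((separable_X_pow_sub_one hn).of_dvd h1).isCoprime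

theorem eq_of_monic_of_red_eq {n : ℕ} (hn : Odd n) {p q : (ZMod 4)[X]} (hp : p.Monic)
    (hq : q.Monic) (hpd : p ∣ X ^ n - 1) (hqd : q ∣ X ^ n - 1) (h : red p = red q) : p = q := by
  have hdeg : p.natDegree = q.natDegree := by
    rw [← hp.natDegree_map (ZMod.castHom (by norm_num : 2 ∣ 4) (ZMod 2)),
      ← hq.natDegree_map (ZMod.castHom (by norm_num : 2 ∣ 4) (ZMod 2))]
    exact congrArg natDegree h
  exact eq_of_monic_of_dvd_of_natDegree_le hq hp
    (dvd_of_red_dvd hn hqd hpd (dvd_of_eq h.symm)) hdeg.le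

/-- Reduction modulo 2 gives `d = g e + 2 w`. Then `d (f h + 2 f) ≡ 2 f (e g + w h)` modulo `X ^ β -
1`, which forces `h ∣ e g`, hence `h ∣ e`, modulo 2. -/
theorem dvd_red_of_dvd_mul {β : ℕ} (hβ : Odd β) {f g h d : (ZMod 4)[X]}
    (hfac : f * h * g = X ^ β - 1) (hd : X ^ β - 1 ∣ d * (f * h + 2 * f)) :
    red (h * g) ∣ red d := by
  have hf := congrArg red hfac
  rw [red_X_pow_sub_one, map_mul, map_mul] at hf
  have hne : red f * red h * red g ≠ 0 :=
    hf ▸ (monic_X_pow_sub_one (ZMod 2) hβ.pos.ne').ne_zero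
  have hg : red g ∣ red d := by
    have h3 := map_dvd red hd
    rw [red_X_pow_sub_one, ← hf, map_mul, map_add, map_mul, map_mul red 2, red_two, zero_mul,
      add_zero, mul_comm (red d)] at h3
    exact (mul_dvd_mul_iff_left (left_ne_zero_of_mul hne)).mp h3
  obtain ⟨e, he⟩ := hg
  obtain ⟨e, rfl⟩ := red_surjective e
  rw [← map_mul] at he
  obtain ⟨w, rfl⟩ := (red_eq_red_iff _ _).mp he
  have h4 : X ^ β - 1 ∣ 2 * (f * (e * g + w * h)) := by
    have e1 : 2 * (f * (e * g + w * h)) = (g * e + 2 * w) * (f * h + 2 * f) -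
        (X ^ β - 1) * e := by
      rw [← hfac]; linear_combination -w * f * four_eq_zero
    rw [e1]
    exact dvd_sub hd (dvd_mul_right _ _)
  have h5 := red_dvd_of_dvd_two_mul hβ.pos.ne' h4
  rw [← hf, map_mul, map_add, map_mul, map_mul, mul_assoc,
    mul_dvd_mul_iff_left (left_ne_zero_of_mul (left_ne_zero_of_mul hne))] at h5
  have hcop : IsCoprime (red h) (red g) :=
    isCoprime_red_of_mul_dvd hβ ⟨f, by rw [← hfac]; ring⟩
  have h6 : red h ∣ red e := by
    have := (dvd_add_left (dvd_mul_left (red h) (red w))).mp ((dvd_mul_right _ _).trans h5)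
    exact hcop.dvd_of_dvd_mul_right this
  rw [map_add, map_mul, map_mul red 2, red_two, zero_mul, add_zero, map_mul, mul_comm]
  exact mul_dvd_mul_left _ h6

namespace HasGenerators

variable {α β : ℕ} {𝒞 : Code α β} {b l : (ZMod 2)[X]} {f g h : (ZMod 4)[X]}

/-- A multiplier of the second generator that kills its quaternary part is divisible by `h g` modulo
2, so the condition `b_dvd_mul` puts its binary contribution in the multiples of `b`. -/
theorem dvd_of_fst_mem (H : HasGenerators 𝒞 b l f g h) (hβ : Odd β)
    {v : Ambient α β} {p : (ZMod 2)[X]} (hv : toR α β v = (mkBin α p, mkQuat β 0)) (hm : v ∈ 𝒞) :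
    b ∣ p := by
  rw [H.eq_code, mem_cyclicCode_iff hv] at hm
  obtain ⟨c, d, h1, h2⟩ := hm
  rw [zero_sub, dvd_neg] at h2
  have h7 : b ∣ red d * l :=
    H.b_dvd_mul.trans (mul_dvd_mul_right (dvd_red_of_dvd_mul hβ H.factor h2) _)
  exact (dvd_sub_left (dvd_add (dvd_mul_left _ _) h7)).mp (H.b_dvd.trans h1)

theorem red_dvd_of_mem (H : HasGenerators 𝒞 b l f g h) {v : Ambient α β} {p : (ZMod 2)[X]}
    {q : (ZMod 4)[X]} (hv : toR α β v = (mkBin α p, mkQuat β q)) (hm : v ∈ 𝒞) :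
    red (f * h) ∣ red q := by
  rw [H.eq_code, mem_cyclicCode_iff hv] at hm
  obtain ⟨c, d, -, h2⟩ := hm
  have h3 := map_dvd red ((Dvd.intro g H.factor).trans h2)
  have e : red (d * (f * h + 2 * f)) = red (f * h) * red d := by
    rw [map_mul, map_add, map_mul red 2, red_two, zero_mul, add_zero, mul_comm]
  rw [map_sub, e] at h3
  exact (dvd_sub_left (dvd_mul_right _ _)).mp h3

/-- A multiplier with even product has the form `g d' + 2 w`, and its product with `f h + 2 f` is
then `2 f (g d' + w h)` modulo `X ^ β - 1`. -/
theorem red_dvd_of_two_mul_mem (H : HasGenerators 𝒞 b l f g h) (hβ : β ≠ 0) {v : Ambient α β}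
    {p : (ZMod 2)[X]} {q : (ZMod 4)[X]} (hv : toR α β v = (mkBin α p, mkQuat β (2 * q)))
    (hm : v ∈ 𝒞) : red f ∣ red q := by
  rw [H.eq_code, mem_cyclicCode_iff hv] at hm
  obtain ⟨c, d, -, h2⟩ := hm
  have hf := congrArg red H.factor
  rw [red_X_pow_sub_one, map_mul, map_mul] at hf
  have hne : red f * red h * red g ≠ 0 := hf ▸ (monic_X_pow_sub_one (ZMod 2) hβ).ne_zero
  have h3 := map_dvd red h2
  have e : red (2 * q - d * (f * h + 2 * f)) = -(red f * red h * red d) := by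
    simp only [map_sub, map_mul, map_add, red_two]; ring
  rw [red_X_pow_sub_one, ← hf, e, dvd_neg,
    mul_dvd_mul_iff_left (left_ne_zero_of_mul hne)] at h3
  obtain ⟨d', hd⟩ := h3
  obtain ⟨d', rfl⟩ := red_surjective d'
  rw [← map_mul] at hd
  obtain ⟨w, rfl⟩ := (red_eq_red_iff _ _).mp hd
  have h4 : X ^ β - 1 ∣ 2 * (q - f * (g * d' + w * h)) := by
    have e1 : 2 * (q - f * (g * d' + w * h)) =
        2 * q - (g * d' + 2 * w) * (f * h + 2 * f) + (X ^ β - 1) * d' := by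
      rw [← H.factor]; linear_combination w * f * four_eq_zero
    rw [e1]
    exact dvd_add h2 (dvd_mul_right _ _)
  have h5 := red_dvd_of_dvd_two_mul hβ h4
  rw [← hf, map_sub, map_mul] at h5
  exact (dvd_sub_left (dvd_mul_right _ _)).mp ((Dvd.intro _ (mul_assoc _ _ _).symm).trans h5)

theorem mem_of_multiplier (H : HasGenerators 𝒞 b l f g h) (c d : (ZMod 4)[X]) {v : Ambient α β}
    (hv : toR α β v = (mkBin α (red c * b + red d * l), mkQuat β (d * (f * h + 2 * f)))) :
    v ∈ 𝒞 := by
  rw [H.eq_code, mem_cyclicCode_iff hv]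
  exact ⟨c, d, by rw [sub_self]; exact dvd_zero _, by rw [sub_self]; exact dvd_zero _⟩

variable {b' l' : (ZMod 2)[X]} {f' g' h' : (ZMod 4)[X]}

theorem b_dvd_b (H : HasGenerators 𝒞 b l f g h) (H' : HasGenerators 𝒞 b' l' f' g' h')
    (hα : α ≠ 0) (hβ : Odd β) : b ∣ b' := by
  obtain ⟨v, hv⟩ := exists_toR_eq hα hβ.pos.ne' b' 0
  exact H.dvd_of_fst_mem hβ hv (H'.mem_of_multiplier 1 0 (by simpa using hv))

theorem red_fh_dvd (H : HasGenerators 𝒞 b l f g h) (H' : HasGenerators 𝒞 b' l' f' g' h')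
    (hα : α ≠ 0) (hβ : Odd β) : red (f * h) ∣ red (f' * h') := by
  obtain ⟨v, hv⟩ := exists_toR_eq hα hβ.pos.ne' l' (f' * h' + 2 * f')
  have h1 := H.red_dvd_of_mem hv (H'.mem_of_multiplier 0 1 (by simpa using hv))
  rwa [map_add, map_mul red 2, red_two, zero_mul, add_zero] at h1

/-- Multiplying the second generator by `2` and by `g'` produces the quaternary parts `2 f' h'` and
`2 f' g'`. As `h'` and `g'` are coprime modulo 2, `f'` is a combination of `f' h'` and `f' g'`
there. -/
theorem red_f_dvd (H : HasGenerators 𝒞 b l f g h) (H' : HasGenerators 𝒞 b' l' f' g' h')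
    (hα : α ≠ 0) (hβ : Odd β) : red f ∣ red f' := by
  obtain ⟨v, hv⟩ := exists_toR_eq hα hβ.pos.ne' 0 (2 * (f' * h'))
  have h1 := H.red_dvd_of_two_mul_mem hβ.pos.ne' hv (H'.mem_of_multiplier 0 2 (by
    rw [hv]
    refine Prod.ext ?_ ((mkQuat_eq_iff _ _).mpr ?_)
    · simp [red_two]
    · refine ⟨0, ?_⟩; linear_combination -f' * four_eq_zero))
  obtain ⟨w, hw⟩ := exists_toR_eq hα hβ.pos.ne' (red g' * l') (2 * (f' * g'))
  have h2 := H.red_dvd_of_two_mul_mem hβ.pos.ne' hw (H'.mem_of_multiplier 0 g' (by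
    rw [hw]
    refine Prod.ext ?_ ((mkQuat_eq_iff _ _).mpr ?_)
    · simp
    · refine ⟨-1, ?_⟩; rw [← H'.factor]; ring))
  obtain ⟨x, y, hxy⟩ : IsCoprime (red h') (red g') :=
    isCoprime_red_of_mul_dvd hβ ⟨f', by rw [← H'.factor]; ring⟩
  have e : red f' = x * red (f' * h') + y * red (f' * g') := by
    rw [map_mul, map_mul]; linear_combination -red f' * hxy
  rw [e]
  exact dvd_add (h1.mul_left _) (h2.mul_left _)

/-- The generator polynomials of a code in standard form are unique. -/
theorem unique (H : HasGenerators 𝒞 b l f g h) (H' : HasGenerators 𝒞 b' l' f' g' h')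
    (hα : α ≠ 0) (hβ : Odd β) : b' = b ∧ l' = l ∧ f' = f ∧ f' * h' = f * h := by
  have hb := eq_of_dvd_dvd (H'.b_dvd_b H hα hβ) (H.b_dvd_b H' hα hβ)
  have hf : f' = f := eq_of_monic_of_red_eq hβ H'.monic_f H.monic_f
    ⟨h' * g', by rw [← H'.factor]; ring⟩ ⟨h * g, by rw [← H.factor]; ring⟩
    (eq_of_dvd_dvd (H'.red_f_dvd H hα hβ) (H.red_f_dvd H' hα hβ))
  have hfh : f' * h' = f * h := eq_of_monic_of_red_eq hβ (H'.monic_f.mul H'.monic_h)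
    (H.monic_f.mul H.monic_h) (Dvd.intro _ H'.factor) (Dvd.intro _ H.factor)
    (eq_of_dvd_dvd (H'.red_fh_dvd H hα hβ) (H.red_fh_dvd H' hα hβ))
  refine ⟨hb, ?_, hf, hfh⟩
  obtain ⟨v, hv⟩ := exists_toR_eq hα hβ.pos.ne' l' (f * h + 2 * f)
  have hm : v ∈ 𝒞 := H'.mem_of_multiplier 0 1 (by rw [hfh, hf]; simpa using hv)
  rw [H.eq_code, mem_cyclicCode_iff hv] at hm
  obtain ⟨c, d, h1, h2⟩ := hm
  -- Both second generators now have the same quaternary part, so `1 - d` annihilates it and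
  -- contributes only multiples of `b` to `l' - l`.
  have h3 := dvd_red_of_dvd_mul hβ H.factor
    (h2.trans (dvd_of_eq (show _ = (1 - d) * (f * h + 2 * f) by ring)))
  have h4 := H.b_dvd_mul.trans (mul_dvd_mul_right h3 l)
  have h5 : b ∣ l' - l := by
    have e : l' - l = (l' - (red c * b + red d * l)) + red c * b - red (1 - d) * l := by
      rw [map_sub, map_one]; ring
    rw [e]
    exact dvd_sub (dvd_add (H.b_dvd.trans h1) (dvd_mul_left _ _)) h4
  rw [← sub_eq_zero]
  exact eq_zero_of_dvd_of_degree_lt h5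
    ((degree_sub_le _ _).trans_lt (max_lt (hb ▸ H'.deg_lt) H.deg_lt))

end HasGenerators

/-! ### The dual code as a system of polynomial conditions. -/

/-- The class of `(p ∣ q)` is orthogonal to the code generated by the classes of the conjugates
of `(b ∣ 0)` and `(l ∣ k)` under `X ↦ X⁻¹`. -/
def IsOrthogonal (α β : ℕ) (b l : (ZMod 2)[X]) (k : (ZMod 4)[X]) (p : (ZMod 2)[X])
    (q : (ZMod 4)[X]) : Prop :=
  X ^ α - 1 ∣ b * p ∧ ∀ d : (ZMod 4)[X],
    twice (cyclicTrace (ZMod 2) α (red d * (l * p))) + cyclicTrace (ZMod 4) β (d * (k * q)) = 0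

theorem isCoprime_X_pow_sub_one {K : Type*} [Field K] {n : ℕ} (hn : n ≠ 0) {p : K[X]}
    (hp : p ∣ X ^ n - 1) (i : ℕ) : IsCoprime p (X ^ i) := by
  refine IsCoprime.of_isCoprime_of_dvd_left (isCoprime_X_pow_of_coeff_zero ?_ i) hp
  simp [coeff_X_pow, hn.symm]

/-- The conjugates need only be known modulo `X ^ m - 1`. The power `X ^ i` in front of `b₁` is a
unit modulo `X ^ α - 1` and drops out, while the powers of `X` in `l₁` and `k₁` must stay, since
they fix the relative shift of the two parts. -/
theorem mem_dual_iff {α β m : ℕ} (hα : α ≠ 0) (hβ : β ≠ 0) (hm : m ≠ 0) (hαm : α ∣ m)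
    (hβm : β ∣ m) {b l b₁ l₁ : (ZMod 2)[X]} {k k₁ : (ZMod 4)[X]} (i : ℕ)
    (hb : X ^ m - 1 ∣ inversion (ZMod 2) m b - X ^ i * b₁)
    (hl : X ^ m - 1 ∣ inversion (ZMod 2) m l - l₁)
    (hk : X ^ m - 1 ∣ inversion (ZMod 4) m k - k₁) {v : Ambient α β} {p : (ZMod 2)[X]}
    {q : (ZMod 4)[X]} (hv : toR α β v = (mkBin α p, mkQuat β q)) :
    v ∈ dual (cyclicCode α β b l k) ↔ IsOrthogonal α β b₁ l₁ k₁ p q := by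
  have hA : (X ^ α - 1 : (ZMod 2)[X]) ∣ X ^ m - 1 := X_pow_sub_one_dvd_of_dvd hαm
  have hB : (X ^ β - 1 : (ZMod 4)[X]) ∣ X ^ m - 1 := X_pow_sub_one_dvd_of_dvd hβm
  obtain ⟨F, hF⟩ : ∃ F : (ZMod 4)[X] → (ZMod 4)[X] → ZMod 4, ∀ c d, F c d =
      twice (cyclicTrace (ZMod 2) α ((red c * (X ^ i * b₁) + red d * l₁) * p)) +
        cyclicTrace (ZMod 4) β (d * (k₁ * q)) := ⟨_, fun _ _ => rfl⟩
  have step1 : v ∈ dual (cyclicCode α β b l k) ↔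
      ∀ c d, F (inversion (ZMod 4) m c) (inversion (ZMod 4) m d) = 0 := by
    have key : ∀ c d : (ZMod 4)[X],
        twice (cyclicTrace (ZMod 2) α
          (inversion (ZMod 2) m (red c * b + red d * l) * p)) +
          cyclicTrace (ZMod 4) β (inversion (ZMod 4) m (d * k) * q) =
        F (inversion (ZMod 4) m c) (inversion (ZMod 4) m d) := by
      intro c d
      rw [hF]
      refine congrArg₂ (· + ·) (congrArg twice (cyclicTrace_congr (hA.trans ?_)))
        (cyclicTrace_congr (hB.trans ?_))
      · have e : inversion (ZMod 2) m (red c * b + red d * l) * p -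
            (red (inversion (ZMod 4) m c) * (X ^ i * b₁) + red (inversion (ZMod 4) m d) * l₁) * p =
            (inversion (ZMod 2) m b - X ^ i * b₁) * (inversion (ZMod 2) m (red c) * p) +
            (inversion (ZMod 2) m l - l₁) * (inversion (ZMod 2) m (red d) * p) := by
          rw [red_inversion, red_inversion, map_add, map_mul, map_mul]; ring
        rw [e]
        exact dvd_add (hb.mul_right _) (hl.mul_right _)
      · have e : inversion (ZMod 4) m (d * k) * q - inversion (ZMod 4) m d * (k₁ * q) =
            (inversion (ZMod 4) m k - k₁) * (inversion (ZMod 4) m d * q) := by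
          rw [map_mul]; ring
        rw [e]
        exact hk.mul_right _
    constructor
    · intro h c d
      obtain ⟨u, hu⟩ := exists_toR_eq hα hβ (red c * b + red d * l) (d * k)
      rw [← key, ← innerProd_eq_cyclicTrace hm hαm hβm hu hv]
      refine h u ((mem_cyclicCode_iff hu).mpr ⟨c, d, ?_, ?_⟩) <;> rw [sub_self] <;>
        exact dvd_zero _
    · intro h u hu
      have hu' := toR_apply u
      obtain ⟨c, d, h1, h2⟩ := (mem_cyclicCode_iff hu').mp hu
      rw [← mkBin_eq_iff] at h1
      rw [← mkQuat_eq_iff] at h2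
      rw [h1, h2] at hu'
      rw [innerProd_eq_cyclicTrace hm hαm hβm hu' hv, key, h]
  -- Inversion is an involution modulo `X ^ α - 1` and `X ^ β - 1`, so inverted multipliers are as
  -- general as arbitrary ones.
  have step2 : ∀ c d, F (inversion (ZMod 4) m (inversion (ZMod 4) m c))
      (inversion (ZMod 4) m (inversion (ZMod 4) m d)) = F c d := by
    intro c d
    rw [hF, hF]
    simp only [red_inversion]
    refine congrArg₂ (· + ·) (congrArg twice (cyclicTrace_congr ?_)) (cyclicTrace_congr ?_)
    · have hc := dvd_inversion_inversion_sub hm hαm (red c)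
      have hd := dvd_inversion_inversion_sub hm hαm (red d)
      have e : ∀ x x' y y' : (ZMod 2)[X], (x * (X ^ i * b₁) + y * l₁) * p -
          (x' * (X ^ i * b₁) + y' * l₁) * p =
          (x - x') * (X ^ i * b₁ * p) + (y - y') * (l₁ * p) := fun x x' y y' => by ring
      rw [e]
      exact dvd_add (hc.mul_right _) (hd.mul_right _)
    · rw [← sub_mul]
      exact (dvd_inversion_inversion_sub hm hβm d).mul_right _
  have step3 : v ∈ dual (cyclicCode α β b l k) ↔ ∀ c d, F c d = 0 := by
    rw [step1]
    exact ⟨fun h c d => by rw [← step2]; exact h _ _, fun h c d => h _ _⟩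
  rw [step3]
  constructor
  · intro h
    constructor
    · have h1 : X ^ α - 1 ∣ X ^ i * (b₁ * p) := by
        refine cyclicTrace_nondegenerate hα fun c => ?_
        obtain ⟨c, rfl⟩ := red_surjective c
        have := h c 0
        rw [hF] at this
        simp only [map_zero, zero_mul, add_zero, twice_eq_zero_iff] at this
        rw [← this]; congr 1; ring
      exact (isCoprime_X_pow_sub_one hα dvd_rfl i).dvd_of_dvd_mul_left h1
    · intro d
      have := h 0 d
      rw [hF] at this
      simpa only [map_zero, zero_mul, zero_add, mul_assoc] using this
  · rintro ⟨⟨w, hw⟩, h⟩ c d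
    rw [← h d, hF]
    refine congrArg (fun x => twice x + _) (cyclicTrace_congr ⟨red c * X ^ i * w, ?_⟩)
    linear_combination red c * X ^ i * hw

namespace IsOrthogonal

variable {α β : ℕ} {b l : (ZMod 2)[X]} {k : (ZMod 4)[X]} {p p' : (ZMod 2)[X]}
  {q q' : (ZMod 4)[X]}

theorem add (H : IsOrthogonal α β b l k p q) (H' : IsOrthogonal α β b l k p' q') :
    IsOrthogonal α β b l k (p + p') (q + q') := by
  refine ⟨by rw [mul_add]; exact dvd_add H.1 H'.1, fun d => ?_⟩
  have h1 := H.2 d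
  have h2 := H'.2 d
  simp only [mul_add, map_add]
  linear_combination h1 + h2

theorem smul (H : IsOrthogonal α β b l k p q) (c : (ZMod 4)[X]) :
    IsOrthogonal α β b l k (red c * p) (c * q) := by
  refine ⟨by rw [mul_left_comm]; exact H.1.mul_left _, fun d => ?_⟩
  have h1 := H.2 (d * c)
  have e1 : red (d * c) * (l * p) = red d * (l * (red c * p)) := by rw [map_mul red]; ring
  have e2 : d * c * (k * q) = d * (k * (c * q)) := by ring
  rwa [e1, e2] at h1

theorem dvd_mul (H : IsOrthogonal α β b l k p 0) (hα : α ≠ 0) : X ^ α - 1 ∣ l * p := by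
  refine cyclicTrace_nondegenerate hα fun c => ?_
  obtain ⟨c, rfl⟩ := red_surjective c
  have h := H.2 c
  rwa [mul_zero, mul_zero, map_zero, add_zero, twice_eq_zero_iff] at h

theorem of_dvd (h : X ^ α - 1 ∣ b * p) (h' : X ^ α - 1 ∣ l * p) :
    IsOrthogonal α β b l k p 0 := by
  refine ⟨h, fun d => ?_⟩
  obtain ⟨w, hw⟩ := h'
  rw [hw, mul_left_comm, cyclicTrace_mul_eq_zero, mul_zero, mul_zero]
  simp

variable {f g h : (ZMod 4)[X]} {i j : ℕ}

/-- In the quaternary product the term with `f h g` vanishes modulo `X ^ β - 1`, leaving `2 f (X ^ i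
h r + X ^ j g t)`. The pairing is thus a sum of two binary traces, and the common factor `b' f`
cancels from the resulting divisibility. -/
theorem iff_dvd (hα : α ≠ 0) (hβ : β ≠ 0) {b' s : (ZMod 2)[X]} (hb : b * b' = X ^ α - 1)
    (hfac : f * h * g = -(X ^ β - 1)) (t r : (ZMod 4)[X]) :
    IsOrthogonal α β b l (X ^ i * (f * h) + 2 * (X ^ j * f)) (b' * s) (g * t + 2 * r) ↔
      b * red h * red g ∣ l * s * red h * red g +
        b * (X ^ i * red h * red r + X ^ j * red g * red t) := by
  have hA := (monic_X_pow_sub_one (ZMod 2) hα).ne_zero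
  have hB := (monic_X_pow_sub_one (ZMod 2) hβ).ne_zero
  have hfr := congrArg red hfac
  rw [map_neg, red_X_pow_sub_one, CharTwo.neg_eq, map_mul, map_mul] at hfr
  have h1 : X ^ α - 1 ∣ b * (b' * s) := ⟨s, by rw [← hb]; ring⟩
  set Q := f * (X ^ i * h * r + X ^ j * g * t) with hQ
  have e : ∀ d : (ZMod 4)[X], cyclicTrace (ZMod 4) β
      (d * ((X ^ i * (f * h) + 2 * (X ^ j * f)) * (g * t + 2 * r))) =
      twice (cyclicTrace (ZMod 2) β (red d * red Q)) := by
    intro d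
    rw [← map_mul, ← cyclicTrace_two_mul]
    refine cyclicTrace_congr ⟨-(d * X ^ i * t), ?_⟩
    rw [hQ]
    linear_combination d * X ^ i * t * hfac + d * X ^ j * f * r * four_eq_zero
  rw [IsOrthogonal, and_iff_right h1]
  simp only [e, ← map_add, twice_eq_zero_iff]
  have e2 : (∀ d : (ZMod 4)[X], cyclicTrace (ZMod 2) α (red d * (l * (b' * s))) +
      cyclicTrace (ZMod 2) β (red d * red Q) = 0) ↔
      ∀ c, cyclicTrace (ZMod 2) α (c * (l * (b' * s))) +
        cyclicTrace (ZMod 2) β (c * red Q) = 0 :=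
    ⟨fun h c => by obtain ⟨c, rfl⟩ := red_surjective c; exact h c, fun h d => h _⟩
  rw [e2, cyclicTrace_add_eq_zero_iff hα hβ]
  have e3 : (X ^ α - 1) * (X ^ β - 1) = b' * red f * (b * red h * red g) := by
    rw [← hb, ← hfr]; ring
  have e4 : l * (b' * s) * (X ^ β - 1) + red Q * (X ^ α - 1) = b' * red f *
      (l * s * red h * red g + b * (X ^ i * red h * red r + X ^ j * red g * red t)) := by
    rw [← hb, ← hfr, hQ]; simp only [map_mul, map_add, map_pow, red_X]; ring
  rw [e3, e4, mul_dvd_mul_iff_left]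
  refine mul_ne_zero (right_ne_zero_of_mul (hb ▸ hA)) ?_
  exact left_ne_zero_of_mul (left_ne_zero_of_mul (hfr ▸ hB))

/-- Even multipliers kill the binary trace; testing with them shows that `f h q` vanishes modulo 2
and `X ^ β - 1`, so `g ∣ q` modulo 2. -/
theorem exists_eq (H : IsOrthogonal α β b l (X ^ i * (f * h) + 2 * (X ^ j * f)) p q)
    (hα : α ≠ 0) (hβ : β ≠ 0) {b' : (ZMod 2)[X]} (hb : b * b' = X ^ α - 1)
    (hfac : f * h * g = -(X ^ β - 1)) :
    ∃ s t r, p = b' * s ∧ q = g * t + 2 * r := by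
  have hA := (monic_X_pow_sub_one (ZMod 2) hα).ne_zero
  have hB := (monic_X_pow_sub_one (ZMod 2) hβ).ne_zero
  have hfr := congrArg red hfac
  rw [map_neg, red_X_pow_sub_one, CharTwo.neg_eq, map_mul, map_mul] at hfr
  obtain ⟨s, hs⟩ : b' ∣ p := by
    have h1 := H.1
    rw [← hb, mul_dvd_mul_iff_left (left_ne_zero_of_mul (hb ▸ hA))] at h1
    exact h1
  have h2 : X ^ β - 1 ∣ 2 * ((X ^ i * (f * h) + 2 * (X ^ j * f)) * q) := by
    refine cyclicTrace_nondegenerate hβ fun c => ?_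
    have h3 := H.2 (2 * c)
    rw [map_mul red, red_two, zero_mul, zero_mul, map_zero, map_zero, zero_add] at h3
    rw [← h3]; congr 1; ring
  have h4 := red_dvd_of_dvd_two_mul hβ h2
  have e : red ((X ^ i * (f * h) + 2 * (X ^ j * f)) * q) =
      red f * red h * (X ^ i * red q) := by
    simp only [map_mul, map_add, map_pow, red_X, red_two]; ring
  rw [e, ← hfr, mul_dvd_mul_iff_left (left_ne_zero_of_mul (hfr ▸ hB))] at h4
  obtain ⟨t, ht⟩ := (isCoprime_X_pow_sub_one hβ (Dvd.intro_left _ hfr) i).dvd_of_dvd_mul_left h4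
  obtain ⟨t, rfl⟩ := red_surjective t
  rw [← map_mul] at ht
  obtain ⟨r, hr⟩ := (red_eq_red_iff _ _).mp ht
  exact ⟨s, t, r, hs, hr⟩

end IsOrthogonal

theorem IsOrthogonal.congr {α β : ℕ} {b l : (ZMod 2)[X]} {k : (ZMod 4)[X]} {p p' : (ZMod 2)[X]}
    {q q' : (ZMod 4)[X]} (H : IsOrthogonal α β b l k p q) (hp : X ^ α - 1 ∣ p' - p)
    (hq : X ^ β - 1 ∣ q' - q) : IsOrthogonal α β b l k p' q' := by
  obtain ⟨v, hv⟩ := hp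
  obtain ⟨w, hw⟩ := hq
  refine ⟨?_, fun d => ?_⟩
  · have e : b * p' = b * p + (X ^ α - 1) * (b * v) := by linear_combination b * hv
    rw [e]
    exact dvd_add H.1 (dvd_mul_right _ _)
  · rw [← H.2 d]
    refine congrArg₂ (· + ·) (congrArg twice (cyclicTrace_congr ⟨red d * l * v, ?_⟩))
      (cyclicTrace_congr ⟨d * k * w, ?_⟩)
    · linear_combination red d * l * hv
    · linear_combination d * k * hw

/-! ### Generators of the dual code. -/

/-- Factorizations relating the reciprocals of the generators of a code (`k` is the reciprocal of
`gcd(b, ℓ)`, and `k * u * v` that of `b`) to the generators `F`, `G`, `H` of its dual. -/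
structure DualFactors (α β : ℕ) (k u v w g₁ h₁ ρ : (ZMod 2)[X]) (f g h F G H : (ZMod 4)[X]) :
    Prop where
  mul_eq : k * u * v * w = X ^ α - 1
  coprime : IsCoprime (u * v) ρ
  factor : f * h * g = -(X ^ β - 1)
  red_g : red g = u * g₁
  red_h : red h = v * h₁
  dual_factor : F * H * G = X ^ β - 1
  red_F : red F = g₁
  red_H : red H = u * h₁
  red_G : red G = red f * v

namespace DualFactors

variable {α β : ℕ} {k u v w g₁ h₁ ρ : (ZMod 2)[X]} {f g h F G H : (ZMod 4)[X]}

/-- Such a `p` is annihilated modulo `X ^ α - 1` by both `k u v` and `k ρ` up to a unit, hence by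
`k`, as `u v` and `ρ` are coprime. -/
theorem dvd_of_isOrthogonal (D : DualFactors α β k u v w g₁ h₁ ρ f g h F G H) (hα : α ≠ 0)
    {e : ℕ} {K : (ZMod 4)[X]} {p : (ZMod 2)[X]}
    (hp : IsOrthogonal α β (k * u * v) (X ^ e * (k * ρ)) K p 0) : u * v * w ∣ p := by
  have hA : k * u * v * w ≠ 0 := D.mul_eq ▸ (monic_X_pow_sub_one (ZMod 2) hα).ne_zero
  have h1 := hp.1
  have h2 := hp.dvd_mul hα
  rw [← D.mul_eq, mul_dvd_mul_iff_left (left_ne_zero_of_mul hA)] at h1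
  obtain ⟨s, rfl⟩ := h1
  have e1 : k * u * v * w = k * w * (u * v) := by ring
  have e2 : X ^ e * (k * ρ) * (w * s) = k * w * (ρ * (X ^ e * s)) := by ring
  rw [← D.mul_eq, e1, e2, mul_dvd_mul_iff_left (mul_ne_zero (left_ne_zero_of_mul
    (left_ne_zero_of_mul (left_ne_zero_of_mul hA))) (right_ne_zero_of_mul hA))] at h2
  have hX : IsCoprime (u * v) (X ^ e) :=
    isCoprime_X_pow_sub_one hα ⟨k * w, by rw [← D.mul_eq]; ring⟩ e
  obtain ⟨t, rfl⟩ := hX.dvd_of_dvd_mul_left (D.coprime.dvd_of_dvd_mul_left h2)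
  exact ⟨t, by ring⟩

/-- This puts `F H + 2 F` in the form `g t + 2 r` required by `IsOrthogonal.iff_dvd`. -/
theorem exists_mul_eq (D : DualFactors α β k u v w g₁ h₁ ρ f g h F G H) (hβ : Odd β) :
    ∃ J, g * J = F * H ∧ red J = h₁ := by
  have hB := (monic_X_pow_sub_one (ZMod 2) hβ.pos.ne').ne_zero
  have hfr := congrArg red D.factor
  rw [map_neg, red_X_pow_sub_one, CharTwo.neg_eq, map_mul, map_mul] at hfr
  have e : red (F * H) = red g * h₁ := by
    rw [map_mul, D.red_F, D.red_H, D.red_g]; ring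
  obtain ⟨J, hJ⟩ := dvd_of_red_dvd hβ ⟨-(f * h), by linear_combination D.factor⟩
    (Dvd.intro _ D.dual_factor) (Dvd.intro _ e.symm)
  refine ⟨J, hJ.symm, ?_⟩
  rw [hJ, map_mul] at e
  exact mul_left_cancel₀ (right_ne_zero_of_mul (hfr ▸ hB)) e

variable {e i j : ℕ} {s l' : (ZMod 2)[X]}

theorem isOrthogonal_generator (D : DualFactors α β k u v w g₁ h₁ ρ f g h F G H) (hα : α ≠ 0)
    (hβ : Odd β) (hs : u * v ∣ X ^ e * ρ * s + X ^ i * v + X ^ j * u)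
    (hl' : u * v * w ∣ l' - w * s) :
    IsOrthogonal α β (k * u * v) (X ^ e * (k * ρ)) (X ^ i * (f * h) + 2 * (X ^ j * f)) l'
      (F * H + 2 * F) := by
  obtain ⟨J, hJ, hJr⟩ := D.exists_mul_eq hβ
  have h1 : IsOrthogonal α β (k * u * v) (X ^ e * (k * ρ))
      (X ^ i * (f * h) + 2 * (X ^ j * f)) (w * s) (g * J + 2 * F) := by
    rw [IsOrthogonal.iff_dvd hα hβ.pos.ne' D.mul_eq D.factor, hJr, D.red_F, D.red_g, D.red_h]
    convert mul_dvd_mul_left (k * u * v * g₁ * h₁) hs using 1 <;> ring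
  obtain ⟨x, hx⟩ := hl'
  have h2 : IsOrthogonal α β (k * u * v) (X ^ e * (k * ρ))
      (X ^ i * (f * h) + 2 * (X ^ j * f)) (u * v * w * x) 0 := by
    refine IsOrthogonal.of_dvd ?_ ?_ <;> rw [← D.mul_eq]
    · exact ⟨u * v * x, by ring⟩
    · exact ⟨X ^ e * ρ * x, by ring⟩
  have h3 := h1.add h2
  rwa [← hx, add_sub_cancel, add_zero, hJ] at h3

theorem exists_dvd_sub (D : DualFactors α β k u v w g₁ h₁ ρ f g h F G H) (hα : α ≠ 0)
    (hβ : Odd β) {p : (ZMod 2)[X]} {q : (ZMod 4)[X]}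
    (hpq : IsOrthogonal α β (k * u * v) (X ^ e * (k * ρ)) (X ^ i * (f * h) + 2 * (X ^ j * f)) p q) :
    ∃ d, X ^ β - 1 ∣ q - d * (F * H + 2 * F) := by
  have hA : k * u * v * w ≠ 0 := D.mul_eq ▸ (monic_X_pow_sub_one (ZMod 2) hα).ne_zero
  have hkuv := left_ne_zero_of_mul hA
  have hfr := congrArg red D.factor
  rw [map_neg, red_X_pow_sub_one, CharTwo.neg_eq, map_mul, map_mul] at hfr
  have hcop : IsCoprime (red g) (red h) :=
    isCoprime_red_of_mul_dvd hβ ⟨-f, by linear_combination D.factor⟩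
  have hgB : red g ∣ X ^ β - 1 := Dvd.intro_left _ hfr
  have hhB : red h ∣ X ^ β - 1 := ⟨red f * red g, by rw [← hfr]; ring⟩
  rw [D.red_g] at hgB
  rw [D.red_h] at hhB
  obtain ⟨s, t, r, rfl, rfl⟩ := hpq.exists_eq hα hβ.pos.ne' D.mul_eq D.factor
  rw [IsOrthogonal.iff_dvd hα hβ.pos.ne' D.mul_eq D.factor, D.red_g, D.red_h] at hpq
  rw [D.red_g, D.red_h] at hcop
  have e1 : k * u * v * (v * h₁) * (u * g₁) = k * u * v * (u * v * (g₁ * h₁)) := by ring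
  have e2 : X ^ e * (k * ρ) * s * (v * h₁) * (u * g₁) + k * u * v *
      (X ^ i * (v * h₁) * red r + X ^ j * (u * g₁) * red t) = k * u * v *
      (X ^ e * ρ * s * (h₁ * g₁) + X ^ i * (v * h₁) * red r + X ^ j * (u * g₁) * red t) := by
    ring
  rw [e1, e2, mul_dvd_mul_iff_left hkuv] at hpq
  -- Modulo `g₁` only the term in `r` survives, and modulo `h₁` only the term in `t`; their
  -- coefficients are units there because `g` and `h` are coprime.
  have hr : g₁ ∣ red r := by
    have h1 : g₁ ∣ v * h₁ * (X ^ i * red r) := by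
      have h2 : g₁ ∣ _ := Dvd.dvd.trans ⟨u * v * h₁, by ring⟩ hpq
      have e3 : X ^ e * ρ * s * (h₁ * g₁) + X ^ i * (v * h₁) * red r +
        X ^ j * (u * g₁) * red t = v * h₁ * (X ^ i * red r) +
        g₁ * (X ^ e * ρ * s * h₁ + X ^ j * u * red t) := by ring
      rw [e3] at h2
      exact (dvd_add_left (dvd_mul_right _ _)).mp h2
    exact (isCoprime_X_pow_sub_one hβ.pos.ne' ((dvd_mul_left _ _).trans hgB) i).dvd_of_dvd_mul_left
      (hcop.of_mul_left_right.dvd_of_dvd_mul_left h1)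
  have ht : h₁ ∣ red t := by
    have h1 : h₁ ∣ u * g₁ * (X ^ j * red t) := by
      have h2 : h₁ ∣ _ := Dvd.dvd.trans ⟨u * v * g₁, by ring⟩ hpq
      have e3 : X ^ e * ρ * s * (h₁ * g₁) + X ^ i * (v * h₁) * red r +
        X ^ j * (u * g₁) * red t = u * g₁ * (X ^ j * red t) +
        h₁ * (X ^ e * ρ * s * g₁ + X ^ i * v * red r) := by ring
      rw [e3] at h2
      exact (dvd_add_left (dvd_mul_right _ _)).mp h2
    exact (isCoprime_X_pow_sub_one hβ.pos.ne' ((dvd_mul_left _ _).trans hhB) j).dvd_of_dvd_mul_left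
      (hcop.of_mul_right_right.symm.dvd_of_dvd_mul_left h1)
  obtain ⟨J, hJ, hJr⟩ := D.exists_mul_eq hβ
  obtain ⟨t', ht'⟩ := ht
  obtain ⟨t', rfl⟩ := red_surjective t'
  rw [← hJr, ← map_mul] at ht'
  obtain ⟨x, rfl⟩ := (red_eq_red_iff _ _).mp ht'
  obtain ⟨y, hy⟩ : g₁ ∣ red (g * x + r) := by
    rw [map_add, map_mul, D.red_g]
    exact dvd_add ((dvd_mul_left _ _).mul_right _) hr
  obtain ⟨y, rfl⟩ := red_surjective y
  rw [← D.red_F, ← map_mul] at hy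
  have h2 := two_mul_congr hy
  obtain ⟨a, c, hac⟩ : IsCoprime (red H) (red G) :=
    isCoprime_red_of_mul_dvd hβ ⟨F, by rw [← D.dual_factor]; ring⟩
  obtain ⟨a, rfl⟩ := red_surjective a
  obtain ⟨c, rfl⟩ := red_surjective c
  have h3 : 2 * (a * H + c * G) = 2 * 1 := two_mul_congr (by
    rw [map_add, map_mul, map_mul, map_one]; exact hac)
  -- By now `q = F H t' + 2 F y`. Since `a H + c G ≡ 1` modulo 2, the multiplier `2 a + c G` carries
  -- `F H + 2 F` to `2 F`, and its complement carries it to `F H`, modulo `X ^ β - 1`.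
  refine ⟨(1 - (2 * a + c * G)) * t' + (2 * a + c * G) * y, c * (t' - y), ?_⟩
  linear_combination t' * hJ + h2 + (t' - y) * c * D.dual_factor + (t' - y) * F * h3 +
    (t' - y) * a * F * four_eq_zero

end DualFactors

instance : Nontrivial (ZMod 4) := ⟨⟨0, 1, by decide⟩⟩

theorem DualFactors.hasGenerators {α β m : ℕ} {k u v w g₁ h₁ ρ b l s : (ZMod 2)[X]}
    {f g h F G H : (ZMod 4)[X]} {𝒞 : Code α β}
    (D : DualFactors α β k u v w g₁ h₁ ρ f.reverse g.reverse h.reverse F G H)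
    (h𝒞 : HasGenerators 𝒞 b l f g h) (hα : α ≠ 0) (hβ : Odd β) (hm : m ≠ 0) (hαm : α ∣ m)
    (hβm : β ∣ m) (hF : F.Monic) (hG : G.Monic) (hH : H.Monic) (hb : b.reverse = k * u * v)
    (hl : l.reverse = k * ρ)
    (hs : u * v ∣ X ^ (m - l.natDegree) * ρ * s + X ^ (m - (f * h).natDegree) * v +
      X ^ (m - f.natDegree) * u) :
    HasGenerators (dual 𝒞) (u * v * w) ((w * s) % (u * v * w)) F G H := by
  have hA := monic_X_pow_sub_one (ZMod 2) hα
  have hAdeg : (X ^ α - 1 : (ZMod 2)[X]).natDegree = α := by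
    simpa using natDegree_X_pow_sub_C (R := ZMod 2) (n := α) (r := 1)
  have hBdeg : (X ^ β - 1 : (ZMod 4)[X]).natDegree = β := by
    simpa using natDegree_X_pow_sub_C (R := ZMod 4) (n := β) (r := 1)
  have hbα : b.natDegree ≤ α := hAdeg ▸ natDegree_le_of_dvd h𝒞.b_dvd hA.ne_zero
  have hαm' := Nat.le_of_dvd (Nat.pos_of_ne_zero hm) hαm
  have hβm' := Nat.le_of_dvd (Nat.pos_of_ne_zero hm) hβm
  have hlb := natDegree_le_natDegree h𝒞.deg_lt.le
  have hdeg : f.natDegree + h.natDegree + g.natDegree = β := by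
    rw [← h𝒞.monic_f.natDegree_mul h𝒞.monic_h,
      ← (h𝒞.monic_f.mul h𝒞.monic_h).natDegree_mul h𝒞.monic_g, h𝒞.factor, hBdeg]
  have hfh : (f * h).natDegree = f.natDegree + h.natDegree :=
    h𝒞.monic_f.natDegree_mul h𝒞.monic_h
  have hmem : ∀ (x : Ambient α β) (p : (ZMod 2)[X]) (q : (ZMod 4)[X]),
      toR α β x = (mkBin α p, mkQuat β q) → (x ∈ dual 𝒞 ↔
        IsOrthogonal α β (k * u * v) (X ^ (m - l.natDegree) * (k * ρ))
          (X ^ (m - (f * h).natDegree) * (f.reverse * h.reverse) +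
            2 * (X ^ (m - f.natDegree) * f.reverse)) p q) := by
    intro x p q hx
    rw [h𝒞.eq_code, ← hb, ← hl, ← reverse_mul_monic h𝒞.monic_f h𝒞.monic_h]
    refine mem_dual_iff hα hβ.pos.ne' hm hαm hβm (m - b.natDegree)
      (dvd_inversion_sub_reverse hm (hbα.trans hαm'))
      (dvd_inversion_sub_reverse hm ((hlb.trans hbα).trans hαm')) ?_ hx
    have h1 := dvd_inversion_sub_reverse hm (p := f * h) (by omega)
    have h2 := dvd_inversion_sub_reverse hm (p := f) (by omega)
    have e : inversion (ZMod 4) m (f * h + 2 * f) - (X ^ (m - (f * h).natDegree) *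
        (f * h).reverse + 2 * (X ^ (m - f.natDegree) * f.reverse)) =
        (inversion (ZMod 4) m (f * h) - X ^ (m - (f * h).natDegree) * (f * h).reverse) +
        2 * (inversion (ZMod 4) m f - X ^ (m - f.natDegree) * f.reverse) := by
      rw [map_add, map_mul _ 2 f, map_ofNat]; ring
    rw [e]
    exact dvd_add h1 (h2.mul_left 2)
  have hne : k * u * v * w ≠ 0 := D.mul_eq ▸ hA.ne_zero
  have e1 : k * u * v * w = k * (u * v * w) := by ring
  have hb0 : u * v * w ≠ 0 := right_ne_zero_of_mul (e1 ▸ hne)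
  have hl' : u * v * w ∣ (w * s) % (u * v * w) - w * s := by
    rw [EuclideanDomain.mod_eq_sub_mul_div]
    exact ⟨-(w * s / (u * v * w)), by ring⟩
  have hgen := D.isOrthogonal_generator hα hβ hs hl'
  refine ⟨hF, hG, hH, D.dual_factor, ?_, degree_mod_lt _ hb0, ?_, ?_⟩
  · rw [← D.mul_eq, e1]; exact dvd_mul_left _ _
  -- Multiplying the second generator by `H G` annihilates its quaternary part: `H G (F H + 2 F) =
  -- (H + 2) F H G`.
  · refine D.dvd_of_isOrthogonal hα ((hgen.smul (H * G)).congr (q' := 0) ?_ ⟨-(H + 2), ?_⟩)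
    · rw [sub_self]; exact dvd_zero _
    · linear_combination -(H + 2) * D.dual_factor
  · ext x
    rw [hmem x _ _ (toR_apply x), mem_cyclicCode_iff (toR_apply x)]
    constructor
    · intro hx
      obtain ⟨d, hd⟩ := D.exists_dvd_sub hα hβ hx
      have h1 := (hx.add (hgen.smul (-d))).congr (q' := 0) (by rw [sub_self]; exact dvd_zero _)
        (dvd_trans (dvd_neg.mpr hd) (dvd_of_eq (by ring)))
      obtain ⟨c, hc⟩ := D.dvd_of_isOrthogonal hα h1
      obtain ⟨c, rfl⟩ := red_surjective c
      refine ⟨c, d, ⟨0, ?_⟩, hd⟩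
      rw [map_neg] at hc
      linear_combination hc
    · rintro ⟨c, d, h1, h2⟩
      have h3 : IsOrthogonal α β (k * u * v) (X ^ (m - l.natDegree) * (k * ρ))
          (X ^ (m - (f * h).natDegree) * (f.reverse * h.reverse) +
            2 * (X ^ (m - f.natDegree) * f.reverse)) (red c * (u * v * w)) 0 := by
        refine IsOrthogonal.of_dvd ?_ ?_ <;> rw [← D.mul_eq]
        · exact ⟨u * v * red c, by ring⟩
        · exact ⟨X ^ (m - l.natDegree) * ρ * red c, by ring⟩
      exact (h3.add (hgen.smul d)).congr h1 (by rwa [zero_add])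

/-! ### Splitting the given generators and solving for the binary part. -/

theorem exists_eq_pgcd_mul {p : (ZMod 2)[X]} (hp : p ≠ 0) (q : (ZMod 2)[X]) :
    ∃ x y, p = pgcd p q * x ∧ q = pgcd p q * y ∧ IsCoprime x y := by
  obtain ⟨x, hx⟩ : pgcd p q ∣ p := EuclideanDomain.gcd_dvd_left p q
  obtain ⟨y, hy⟩ : pgcd p q ∣ q := EuclideanDomain.gcd_dvd_right p q
  refine ⟨x, y, hx, hy, EuclideanDomain.gcdA p q, EuclideanDomain.gcdB p q, ?_⟩
  have h0 : pgcd p q ≠ 0 := fun h0 => hp (by rw [hx, h0, zero_mul])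
  have h1 : pgcd p q = p * EuclideanDomain.gcdA p q + q * EuclideanDomain.gcdB p q :=
    EuclideanDomain.gcd_eq_gcd_ab p q
  refine mul_left_cancel₀ h0 ?_
  linear_combination -h1 - EuclideanDomain.gcdA p q * hx - EuclideanDomain.gcdB p q * hy

theorem pgcd_mul_left_mul {d x y : (ZMod 2)[X]} (h : IsCoprime x y) :
    pgcd (d * x) (d * y) = d := by
  refine eq_of_dvd_dvd ?_ (EuclideanDomain.dvd_gcd (dvd_mul_right _ _) (dvd_mul_right _ _))
  obtain ⟨a, c, hac⟩ := h
  have h1 : pgcd (d * x) (d * y) ∣ d * x := EuclideanDomain.gcd_dvd_left _ _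
  have h2 : pgcd (d * x) (d * y) ∣ d * y := EuclideanDomain.gcd_dvd_right _ _
  have e : d = d * x * a + d * y * c := by linear_combination -d * hac
  exact (dvd_add (h1.mul_right a) (h2.mul_right c)).trans (dvd_of_eq e.symm)

/-- The reciprocals of the generators of a code in standard form, split along
`gcd(b, ℓ) ∣ gcd(b, ℓ g) ∣ b`. -/
theorem HasGenerators.exists_reverse_eq {α β : ℕ} {𝒞 : Code α β} {b l : (ZMod 2)[X]}
    {f g h : (ZMod 4)[X]} (H : HasGenerators 𝒞 b l f g h) (hα : α ≠ 0) :
    ∃ k u v w g₁ h₁ ρ : (ZMod 2)[X], (pgcd b l).reverse = k ∧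
      (pgcd b (l * red g)).reverse = k * u ∧ b.reverse = k * u * v ∧
      (l / pgcd b l).reverse = ρ ∧ l.reverse = k * ρ ∧ X ^ α - 1 = k * u * v * w ∧
      (red g).reverse = u * g₁ ∧ (red h).reverse = v * h₁ ∧ IsCoprime (u * v) ρ := by
  have hb0 : b ≠ 0 := ne_zero_of_dvd_ne_zero (monic_X_pow_sub_one (ZMod 2) hα).ne_zero H.b_dvd
  obtain ⟨w, hw⟩ := reverse_dvd H.b_dvd
  rw [reverse_X_pow_sub_one_two] at hw
  obtain ⟨x, ρ, hx, hρ, hcop⟩ := exists_eq_pgcd_mul hb0 l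
  have hdvd := H.b_dvd_mul
  set k := pgcd b l with hk
  have hk0 : k ≠ 0 := left_ne_zero_of_mul (hx ▸ hb0)
  have hx0 : x ≠ 0 := right_ne_zero_of_mul (hx ▸ hb0)
  -- Let `x = b / gcd(b, ℓ)` split as `u v` with `u = gcd(x, g)`. As `b ∣ h g ℓ` gives `x ∣ h g`,
  -- the cofactor `v` divides `h`.
  obtain ⟨v, g₁, hv, hg₁, hcop'⟩ := exists_eq_pgcd_mul hx0 (red g)
  set u := pgcd x (red g) with hu
  have hu0 : u ≠ 0 := left_ne_zero_of_mul (hv ▸ hx0)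
  have hxhg : x ∣ red h * red g := by
    rw [hx, hρ, map_mul, mul_left_comm, mul_dvd_mul_iff_left hk0] at hdvd
    exact hcop.dvd_of_dvd_mul_right hdvd
  obtain ⟨h₁, hh₁⟩ : v ∣ red h := by
    rw [hv, hg₁, mul_left_comm, mul_dvd_mul_iff_left hu0] at hxhg
    exact hcop'.dvd_of_dvd_mul_right hxhg
  have hgcd : pgcd b (l * red g) = k * u := by
    have e1 : b = k * u * v := by rw [mul_assoc, ← hv, ← hx]
    have e2 : l * red g = k * u * (ρ * g₁) := by
      linear_combination red g * hρ + k * ρ * hg₁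
    rw [e1, e2]
    refine pgcd_mul_left_mul (IsCoprime.mul_right ?_ hcop')
    rw [hv] at hcop
    exact hcop.of_mul_left_right
  have hbr : b.reverse = k.reverse * u.reverse * v.reverse := by
    rw [hx, hv, reverse_mul_of_domain, reverse_mul_of_domain, mul_assoc]
  have hlρ : l / k = ρ := by
    conv_lhs => rw [hρ]
    exact mul_div_cancel_left₀ ρ hk0
  refine ⟨k.reverse, u.reverse, v.reverse, w, g₁.reverse, h₁.reverse, ρ.reverse, rfl, ?_, hbr,
    by rw [hlρ], ?_, by rw [← hbr, hw], ?_, ?_, ?_⟩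
  · rw [hgcd, reverse_mul_of_domain]
  · conv_lhs => rw [hρ]
    exact reverse_mul_of_domain _ _
  · conv_lhs => rw [hg₁]
    exact reverse_mul_of_domain _ _
  · rw [hh₁, reverse_mul_of_domain]
  · rw [← reverse_mul_of_domain, ← hv]
    exact isCoprime_reverse hx0 hcop

/-- Modulo 2 the reciprocal factorization regroups as `g₁ · (u h₁) · (f* v)`; separability makes the
three factors coprime, and Hensel's lemma is applied twice. -/
theorem exists_dualFactors {α β : ℕ} {𝒞 : Code α β} {b l : (ZMod 2)[X]}
    {f g h : (ZMod 4)[X]} (h𝒞 : HasGenerators 𝒞 b l f g h) (hβ : Odd β)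
    {k u v w g₁ h₁ ρ : (ZMod 2)[X]} (hw : X ^ α - 1 = k * u * v * w)
    (hg : (red g).reverse = u * g₁) (hh : (red h).reverse = v * h₁)
    (hcop : IsCoprime (u * v) ρ) :
    ∃ F G H : (ZMod 4)[X], F.Monic ∧ G.Monic ∧ H.Monic ∧
      DualFactors α β k u v w g₁ h₁ ρ f.reverse g.reverse h.reverse F G H := by
  have hfac : f.reverse * h.reverse * g.reverse = -(X ^ β - 1) := by
    rw [← reverse_mul_monic h𝒞.monic_f h𝒞.monic_h,
      ← reverse_mul_monic (h𝒞.monic_f.mul h𝒞.monic_h) h𝒞.monic_g, h𝒞.factor,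
      reverse_X_pow_sub_one]
  have hfr := congrArg red hfac
  rw [map_neg, red_X_pow_sub_one, CharTwo.neg_eq, map_mul, map_mul, red_reverse h𝒞.monic_h,
    red_reverse h𝒞.monic_g, hg, hh] at hfr
  have hsep := separable_X_pow_sub_one hβ
  have e : (X ^ β - 1 : (ZMod 2)[X]) = g₁ * (u * h₁ * (red f.reverse * v)) := by
    rw [← hfr]; ring
  rw [e] at hsep
  obtain ⟨F, P, hF, hP, hFr, hPr, hFP⟩ := exists_lift_factorization
    (monic_X_pow_sub_one (ZMod 4) hβ.pos.ne') ((red_X_pow_sub_one β).trans e) hsep.isCoprime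
  obtain ⟨H, G, hH, hG, hHr, hGr, hHG⟩ := exists_lift_factorization hP hPr
    hsep.of_mul_right.isCoprime
  exact ⟨F, G, H, hF, hG, hH, hw.symm, hcop, hfac, by rw [red_reverse h𝒞.monic_g, hg],
    by rw [red_reverse h𝒞.monic_h, hh], by rw [mul_assoc, hHG, hFP], hFr, hHr, hGr⟩

/-- Since `X ^ e X ^ d = X ^ m ≡ 1`, each `μ` inverts `X ^ e ρ` for its modulus; `μ₁` needs only
modulus `v` because it is multiplied by `u`. The product is then `u X ^ j + v X ^ i`, which cancels
in characteristic 2. -/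
theorem dvd_of_congruences {m i j d e : ℕ} {u v ρ σ₁ σ₂ μ₁ μ₂ : (ZMod 2)[X]}
    (hde : e + d = m) (hm : u * v ∣ X ^ m - 1) (h₁ : v ∣ ρ * σ₁ - 1)
    (h₂ : u * v ∣ ρ * σ₂ - 1) (h₁' : v ∣ μ₁ - X ^ d * σ₁) (h₂' : u * v ∣ μ₂ - X ^ d * σ₂) :
    u * v ∣ X ^ e * ρ * (u * X ^ j * μ₁ + v * X ^ i * μ₂) + X ^ i * v + X ^ j * u := by
  obtain ⟨y, hy⟩ := hm
  obtain ⟨a₁, ha₁⟩ := h₁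
  obtain ⟨a₂, ha₂⟩ := h₂
  obtain ⟨c₁, hc₁⟩ := h₁'
  obtain ⟨c₂, hc₂⟩ := h₂'
  rw [← hde, pow_add] at hy
  have h2 : (2 : (ZMod 2)[X]) = 0 := CharTwo.two_eq_zero
  refine ⟨X ^ j * (X ^ e * ρ * c₁ + X ^ e * X ^ d * a₁ + u * y) +
    X ^ i * v * (X ^ e * ρ * c₂ + X ^ e * X ^ d * a₂ + y), ?_⟩
  linear_combination u * X ^ j * (X ^ e * ρ * hc₁ + X ^ e * X ^ d * ha₁ + hy) +
    v * X ^ i * (X ^ e * ρ * hc₂ + X ^ e * X ^ d * ha₂ + hy) + (u * X ^ j + v * X ^ i) * h2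

end Z2Z4

/-! ### The main theorem. -/

open Z2Z4 in
theorem mainTheorem1 (α β : ℕ) (hα : 0 < α) (hβ : Odd β)
    (𝒞 : Code α β) (b l : (ZMod 2)[X]) (f g h : (ZMod 4)[X])
    (h𝒞 : HasGenerators 𝒞 b l f g h) :
    -- the dual code has generators in standard form
    (∃ (b' l' : (ZMod 2)[X]) (f' g' h' : (ZMod 4)[X]),
      HasGenerators (dual 𝒞) b' l' f' g' h') ∧
    -- and any such generators are given by the following formulas
    ∀ (b' l' : (ZMod 2)[X]) (f' g' h' : (ZMod 4)[X]),
      HasGenerators (dual 𝒞) b' l' f' g' h' →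
      ((pgcd b l).reverse ∣ X ^ α - 1 ∧
        b' = (X ^ α - 1) / (pgcd b l).reverse) ∧
      ((red f).reverse * b.reverse ∣ (X ^ β - 1) * (pgcd b (l * red g)).reverse ∧
        IsHenselLift β
          ((X ^ β - 1) * (pgcd b (l * red g)).reverse / ((red f).reverse * b.reverse))
          (f' * h')) ∧
      ((red f).reverse * (red h).reverse * (pgcd b (l * red g)).reverse ∣
          (X ^ β - 1) * (pgcd b l).reverse ∧
        IsHenselLift β
          ((X ^ β - 1) * (pgcd b l).reverse /
            ((red f).reverse * (red h).reverse * (pgcd b (l * red g)).reverse))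
          f') ∧
      (b.reverse ∣ X ^ α - 1 ∧
        (pgcd b l).reverse ∣ (pgcd b (l * red g)).reverse ∧
        (pgcd b (l * red g)).reverse ∣ b.reverse ∧
        (pgcd b l).reverse ∣ b.reverse ∧
        -- `ρ* = (ℓ / gcd(b, ℓ))*` is invertible modulo both moduli
        (∃ σ₁ : (ZMod 2)[X], b.reverse / (pgcd b (l * red g)).reverse ∣
          (l / pgcd b l).reverse * σ₁ - 1) ∧
        (∃ σ₂ : (ZMod 2)[X], b.reverse / (pgcd b l).reverse ∣
          (l / pgcd b l).reverse * σ₂ - 1) ∧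
        -- for all inverses `σᵢ` of `ρ*` and all `μᵢ` congruent to `x^(deg ℓ) σᵢ`
        ∀ σ₁ σ₂ μ₁ μ₂ : (ZMod 2)[X],
          b.reverse / (pgcd b (l * red g)).reverse ∣ (l / pgcd b l).reverse * σ₁ - 1 →
          b.reverse / (pgcd b l).reverse ∣ (l / pgcd b l).reverse * σ₂ - 1 →
          b.reverse / (pgcd b (l * red g)).reverse ∣ μ₁ - X ^ l.natDegree * σ₁ →
          b.reverse / (pgcd b l).reverse ∣ μ₂ - X ^ l.natDegree * σ₂ →
          l' = ((X ^ α - 1) / b.reverse *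
            ((pgcd b (l * red g)).reverse / (pgcd b l).reverse *
                X ^ (Nat.lcm α β - f.natDegree) * μ₁ +
              b.reverse / (pgcd b (l * red g)).reverse *
                X ^ (Nat.lcm α β - (f * h).natDegree) * μ₂)) % b') := by
  have hα0 : α ≠ 0 := hα.ne'
  have hm : Nat.lcm α β ≠ 0 := Nat.lcm_ne_zero hα0 hβ.pos.ne'
  have hαm := Nat.dvd_lcm_left α β
  have hld : Nat.lcm α β - l.natDegree + l.natDegree = Nat.lcm α β := by
    have h1 : b.natDegree ≤ α := by
      have h2 := natDegree_le_of_dvd h𝒞.b_dvd (monic_X_pow_sub_one (ZMod 2) hα0).ne_zero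
      rwa [show (X ^ α - 1 : (ZMod 2)[X]).natDegree = α by
        simpa using natDegree_X_pow_sub_C (R := ZMod 2) (n := α) (r := 1)] at h2
    have h3 := natDegree_le_natDegree h𝒞.deg_lt.le
    have h4 := Nat.le_of_dvd (Nat.pos_of_ne_zero hm) hαm
    omega
  obtain ⟨k, u, v, w, g₁, h₁, ρ, hk, hku, hb, hρ, hl, hw, hg, hh, hcop⟩ :=
    h𝒞.exists_reverse_eq hα0
  obtain ⟨F, G, H, hF, hG, hH, D⟩ := exists_dualFactors h𝒞 hβ hw hg hh hcop
  have hgen := fun s => D.hasGenerators (s := s) h𝒞 hα0 hβ hm hαm (Nat.dvd_lcm_right α β)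
    hF hG hH hb hl
  have hinv : ∃ σ, u * v ∣ ρ * σ - 1 := by
    obtain ⟨x, y, hxy⟩ := hcop
    exact ⟨y, -x, by linear_combination hxy⟩
  have hinv' : ∃ σ, v ∣ ρ * σ - 1 := hinv.imp fun σ hσ => (dvd_mul_left v u).trans hσ
  have hdual : ∀ σ₁ σ₂ μ₁ μ₂ : (ZMod 2)[X], v ∣ ρ * σ₁ - 1 → u * v ∣ ρ * σ₂ - 1 →
      v ∣ μ₁ - X ^ l.natDegree * σ₁ → u * v ∣ μ₂ - X ^ l.natDegree * σ₂ →
      HasGenerators (dual 𝒞) (u * v * w) ((w * (u * X ^ (Nat.lcm α β - f.natDegree) * μ₁ +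
        v * X ^ (Nat.lcm α β - (f * h).natDegree) * μ₂)) % (u * v * w)) F G H :=
    fun σ₁ σ₂ μ₁ μ₂ a₁ a₂ c₁ c₂ => by
      have hdvd : u * v ∣ X ^ Nat.lcm α β - 1 := by
        refine Dvd.dvd.trans ⟨k * w, ?_⟩ (X_pow_sub_one_dvd_of_dvd hαm)
        rw [hw]; ring
      exact hgen _ (dvd_of_congruences hld hdvd a₁ a₂ c₁ c₂)
  obtain ⟨τ₁, hτ₁⟩ := hinv'
  obtain ⟨τ₂, hτ₂⟩ := hinv
  have hD := hdual τ₁ τ₂ _ _ hτ₁ hτ₂ (by rw [sub_self]; exact dvd_zero _)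
    (by rw [sub_self]; exact dvd_zero _)
  refine ⟨⟨_, _, _, _, _, hD⟩, ?_⟩
  intro b' l' f' g' h' H'
  obtain ⟨hb', -, hf', hfh'⟩ := hD.unique H' hα0 hβ
  have hne : k * u * v * w ≠ 0 := hw ▸ (monic_X_pow_sub_one (ZMod 2) hα0).ne_zero
  have hkuv := left_ne_zero_of_mul hne
  have hk0 := left_ne_zero_of_mul (left_ne_zero_of_mul hkuv)
  have hku0 := left_ne_zero_of_mul hkuv
  have hfr := congrArg red D.factor
  rw [map_neg, red_X_pow_sub_one, CharTwo.neg_eq, map_mul, map_mul, red_reverse h𝒞.monic_f,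
    D.red_g, D.red_h] at hfr
  have hBne := (monic_X_pow_sub_one (ZMod 2) hβ.pos.ne').ne_zero
  have hf0 : (red f).reverse ≠ 0 := left_ne_zero_of_mul (left_ne_zero_of_mul (hfr ▸ hBne))
  have hh0 : v * h₁ ≠ 0 := right_ne_zero_of_mul (left_ne_zero_of_mul (hfr ▸ hBne))
  rw [hk, hku, hb, hρ, hh]
  have q₁ : (X ^ α - 1) / k = u * v * w := by
    rw [hw, mul_assoc, mul_assoc, mul_div_cancel_left₀ _ hk0, mul_assoc]
  have q₂ : (X ^ β - 1) * (k * u) = (red f).reverse * (k * u * v) * (g₁ * (u * h₁)) := by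
    rw [← hfr]; ring
  have q₃ : (X ^ β - 1) * k = (red f).reverse * (v * h₁) * (k * u) * g₁ := by
    rw [← hfr]; ring
  have q₄ : (X ^ α - 1) / (k * u * v) = w := by rw [hw, mul_div_cancel_left₀ _ hkuv]
  have q₅ : k * u / k = u := mul_div_cancel_left₀ u hk0
  have q₆ : k * u * v / (k * u) = v := mul_div_cancel_left₀ v hku0
  have q₇ : k * u * v / k = u * v := by rw [mul_assoc, mul_div_cancel_left₀ _ hk0]
  refine ⟨⟨?_, by rw [q₁, hb']⟩, ⟨Dvd.intro _ q₂.symm, H'.monic_f.mul H'.monic_h,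
    Dvd.intro _ H'.factor, ?_⟩, ⟨Dvd.intro _ q₃.symm, H'.monic_f,
    Dvd.intro _ ((mul_assoc _ _ _).symm.trans H'.factor), ?_⟩, ?_⟩
  · rw [hw, mul_assoc, mul_assoc]; exact dvd_mul_right _ _
  · rw [q₂, mul_div_cancel_left₀ _ (mul_ne_zero hf0 hkuv), hfh', map_mul, D.red_F, D.red_H]
  · rw [q₃, mul_div_cancel_left₀ _ (mul_ne_zero (mul_ne_zero hf0 hh0) hku0), hf', D.red_F]
  · rw [q₄, q₅, q₆, q₇]
    refine ⟨Dvd.intro _ hw.symm, dvd_mul_right _ _, dvd_mul_right _ _,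
      (dvd_mul_right k u).mul_right v, ⟨τ₁, hτ₁⟩, ⟨τ₂, hτ₂⟩, ?_⟩
    intro σ₁ σ₂ μ₁ μ₂ a₁ a₂ c₁ c₂
    rw [hb']
    -- Every admissible choice of `μ₁`, `μ₂` gives standard generators of the same dual, so
    -- uniqueness makes the remainder independent of the choice.
    exact ((hdual σ₁ σ₂ μ₁ μ₂ a₁ a₂ c₁ c₂).unique H' hα0 hβ).2.1
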